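/- **Conventions.** For a $K$-mode bosonic system with Fock basis $|n\rangle$, $n\in\mathbb N^K$, let $a_j$ be the annihilation operators and let $x_j=a_j+a_j^\dagger$, $p_j=-i(a_j-a_j^\dagger)$ be the quadratures. The covariance matrix (CM) of a state $\rho$ with finite second moments is $\Gamma_{ij}=\tfrac12\operatorname{Tr}\big(\rho(\Delta R_i\Delta R_j+\Delta R_j\Delta R_i)\big)$, where $R=(x_1,p_1,\dots,x_K,p_K)$ and $\Delta R_i=R_i-\operatorname{Tr}(\rho R_i)$; thus the vacuum has CM equal to the identity. Let $D(\alpha)=\exp\big(\sum_j(\alpha_ja_j^\dagger-\bar\alpha_ja_j)\big)$, $\alpha\in\mathbb C^K$, be the displacement operators. A state $\rho$ is Gaussian if its characteristic function $\xi\mapsto\operatorname{Tr}(\rho D(\xi))$ is Gaussian, i.e. the exponential of a polynomial $i\,w\cdot d-\tfrac12 w\cdot Vw$ in the real phase-space vector $w=(\operatorname{Im}\xi_1,-\operatorname{Re}\xi_1,\dots,\operatorname{Im}\xi_K,-\operatorname{Re}\xi_K)$, with $d$ and $V$ real. For $r\ge 0$ the two-mode squeezed vacuum state (TMSVS) is $|\psi^r\rangle=\sqrt{1-\tanh^2r}\,\sum_{n\ge0}\tanh^n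 r\,|nn\rangle$. **Theorem (general entanglement swapping with a Gaussian POVM).** Let $r_0,r_1,r_2\ge0$. Let $S$ and $R$ share the TMSVS $|\psi^{r_1}\rangle_{SR_1}$ and let $R$ and $T$ share the TMSVS $|\psi^{r_2}\rangle_{R_2T}$. Let $R$ measure its two modes $R_1R_2$ with the Gaussian POVM $\Pi(\alpha)=\pi^{-2}D(\alpha)|\psi^{r_0}\rangle\langle\psi^{r_0}|D(\alpha)^\dagger$, $\alpha\in\mathbb C^2$, whose seed state is the TMSVS $|\psi^{r_0}\rangle$, and put $\chi^{(0)}=\tanh r_0$. Then there is an $r\ge0$ with $$\tanh r=\chi^{(0)}\tanh r_1\tanh r_2$$ such that for every outcome $\alpha\in\mathbb C^2$ the outcome density $\operatorname{Tr}\big((\Pi(\alpha)\otimes I_{ST})\rho\big)$, where $\rho=|\Psi\rangle\langle\Psi|$ and $|\Psi\rangle=|\psi^{r_1}\rangle_{SR_1}\otimes|\psi^{r_2}\rangle_{R_2T}$, is positive, and the post-measurement state $$\rho_\alpha^{ST}=\frac{\operatorname{Tr}_R\big((\Pi(\alpha)\otimes I_{ST})\rho\big)}{\operatorname{Tr}\big((\Pi(\alpha)\otimes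 I_{ST})\rho\big)}$$ between $S$ and $T$ is a pure Gaussian state $|\psi_\alpha\rangle\langle\psi_\alpha|$ with CM $$\Gamma_{ST}=\begin{pmatrix}\cosh 2r\,I_2&\sinh 2r\,Z\\ \sinh 2r\,Z&\cosh 2r\,I_2\end{pmatrix},\qquad Z=\begin{pmatrix}1&0\\0&-1\end{pmatrix}.$$ In particular the CM does not depend on the outcome $\alpha$. -/

import Mathlib

noncomputable section

namespace GaussianSwap

/-! ## Fock space, ladder operators and quadratures -/

/-- Labels `n = (n_1, …, n_K)` of the Fock (photon number) basis `|n⟩` of a `K`-mode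
bosonic system. -/
abbrev FockIndex (K : ℕ) : Type := Fin K → ℕ

/-- The `K`-mode Hilbert space, in the Fock basis. -/
abbrev FockSpace (K : ℕ) : Type := lp (fun _ : FockIndex K => ℂ) 2

/-- Formal operators: linear maps on arbitrary coefficient families `ψ = ∑ ψ(n) |n⟩`.  An unbounded
operator given by such a map acts on those vectors whose image is square summable. -/
abbrev FormalOp (K : ℕ) : Type := Module.End ℂ (FockIndex K → ℂ)

/-- Annihilation operator of mode `j`: `a_j |n⟩ = √n_j |n - e_j⟩`, so that
`(a_j ψ)(n) = √(n_j + 1) ψ(n + e_j)`. -/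
def annihilate {K : ℕ} (j : Fin K) : FormalOp K where
  toFun ψ n := (Real.sqrt (n j + 1) : ℂ) * ψ (n + Pi.single j 1)
  map_add' ψ φ := by funext n; simp [mul_add]
  map_smul' c ψ := by funext n; simp [mul_left_comm]

/-- Creation operator of mode `j`: `a_j† |n⟩ = √(n_j + 1) |n + e_j⟩`, so that
`(a_j† ψ)(n) = √n_j ψ(n - e_j)`, which is `0` for `n_j = 0`. -/
def create {K : ℕ} (j : Fin K) : FormalOp K where
  toFun ψ n := (Real.sqrt (n j) : ℂ) * ψ (n - Pi.single j 1)
  map_add' ψ φ := by funext n; simp [mul_add]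
  map_smul' c ψ := by funext n; simp [mul_left_comm]

/-- The vector of quadratures `(x_1, p_1, …, x_K, p_K)`, where `(j, 0)` labels
`x_j = a_j + a_j†` and `(j, 1)` labels `p_j = -i (a_j - a_j†)`.  In this normalization the
covariance matrix of the vacuum is the identity. -/
def quadrature {K : ℕ} (i : Fin K × Fin 2) : FormalOp K :=
  if i.2 = 0 then annihilate i.1 + create i.1
  else (-Complex.I) • (annihilate i.1 - create i.1)

/-! ## Operators as matrices in an orthonormal basis

Bounded operators and density operators are represented by their matrices
`⟨m| X |n⟩ = X m n` in the Fock basis. -/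

/-- Matrix of the product of two operators. -/
def opMul {ι : Type} (X Y : Matrix ι ι ℂ) : Matrix ι ι ℂ :=
  Matrix.of fun m n => ∑' k, X m k * Y k n

/-- The trace. -/
def opTrace {ι : Type} (X : Matrix ι ι ℂ) : ℂ := ∑' n, X n n

/-- The rank one operator `|ψ⟩⟨ψ|`. -/
def pureState {ι : Type} (ψ : ι → ℂ) : Matrix ι ι ℂ := Matrix.vecMulVec ψ (star ψ)

/-- The anti-Hermitian operator `∑_j (α_j a_j† - conj α_j a_j)`. -/
def displacementGenerator {K : ℕ} (α : Fin K → ℂ) : FormalOp K :=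
  ∑ j, (α j • create j - (starRingEnd ℂ) (α j) • annihilate j)

/-- The `K`-mode Weyl displacement operator `D(α) = exp (∑_j (α_j a_j† - conj α_j a_j))`, through its
matrix elements `⟨m| D(α) |n⟩ = ∑_k ⟨m| (∑_j (α_j a_j† - conj α_j a_j))^k |n⟩ / k!`. (The Fock
vectors are analytic vectors of the exponent, so that the exponential series converges on them, and
`D(α)` is the bounded operator with this matrix.) -/
def displacement {K : ℕ} (α : Fin K → ℂ) : Matrix (FockIndex K) (FockIndex K) ℂ :=
  Matrix.of fun m n =>
    ∑' k : ℕ, ((k.factorial : ℂ))⁻¹ * ((displacementGenerator α ^ k) (Pi.single n 1)) m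

/-! ## Moments, covariance matrices and Gaussian states -/

/-- `Tr (O ρ)` exists and equals `z`; here `(O ρ)(n, n)` is the `n`-th entry of `O` applied to the
`n`-th column of `ρ`. -/
def HasExpectation {K : ℕ} (ρ : Matrix (FockIndex K) (FockIndex K) ℂ) (O : FormalOp K) (z : ℂ) :
    Prop :=
  HasSum (fun n => O (fun m => ρ m n) n) z

/-- The state `ρ` has finite second moments, that is, finite mean total photon number. -/
def HasFiniteSecondMoments {K : ℕ} (ρ : Matrix (FockIndex K) (FockIndex K) ℂ) : Prop :=
  Summable fun n : FockIndex K => (∑ j, (n j : ℝ)) * (ρ n n).re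

/-- `Γ` is the covariance matrix of the state `ρ`: the second moments are finite and, with
`ΔR_i = R_i - Tr (R_i ρ)`, `Γ i j = (1/2) Tr ((ΔR_i ΔR_j + ΔR_j ΔR_i) ρ)`. -/
def IsCovarianceMatrix {K : ℕ} (ρ : Matrix (FockIndex K) (FockIndex K) ℂ)
    (Γ : Matrix (Fin K × Fin 2) (Fin K × Fin 2) ℝ) : Prop :=
  HasFiniteSecondMoments ρ ∧
  ∃ d : Fin K × Fin 2 → ℝ,
    (∀ i, HasExpectation ρ (quadrature i) (d i : ℂ)) ∧
    ∀ i j, HasExpectation ρ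
      ((1 / 2 : ℂ) •
        ((quadrature i - (d i : ℂ) • (1 : FormalOp K)) *
            (quadrature j - (d j : ℂ) • (1 : FormalOp K)) +
          (quadrature j - (d j : ℂ) • (1 : FormalOp K)) *
            (quadrature i - (d i : ℂ) • (1 : FormalOp K))))
      (Γ i j : ℂ)

/-- The (Weyl) characteristic function `ξ ↦ Tr (ρ D(ξ))`. -/
def characteristicFunction {K : ℕ} (ρ : Matrix (FockIndex K) (FockIndex K) ℂ)
    (ξ : Fin K → ℂ) : ℂ :=
  opTrace (opMul ρ (displacement ξ))

/-- The real phase space vector `w` of `ξ`, for which `D(ξ) = exp (i ∑_i w_i R_i)`. -/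
def phaseVector {K : ℕ} (ξ : Fin K → ℂ) (i : Fin K × Fin 2) : ℝ :=
  if i.2 = 0 then (ξ i.1).im else -(ξ i.1).re

/-- A state is Gaussian when its characteristic function is Gaussian:
`Tr (ρ D(ξ)) = exp (i w·d - w·V w / 2)`. -/
def IsGaussian {K : ℕ} (ρ : Matrix (FockIndex K) (FockIndex K) ℂ) : Prop :=
  ∃ (d : Fin K × Fin 2 → ℝ) (V : Matrix (Fin K × Fin 2) (Fin K × Fin 2) ℝ),
    ∀ ξ : Fin K → ℂ, characteristicFunction ρ ξ =
      Complex.exp (Complex.I * ((phaseVector ξ ⬝ᵥ d : ℝ) : ℂ)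
        - ((phaseVector ξ ⬝ᵥ V.mulVec (phaseVector ξ) : ℝ) : ℂ) / 2)

/-! ## Gaussian measurements and post-measurement states -/

/-- The element `Π(α) = π^{-K} D(α) ϖ D(α)†` of the POVM with seed state `ϖ`. -/
def povmElement {K : ℕ} (seed : Matrix (FockIndex K) (FockIndex K) ℂ) (α : Fin K → ℂ) :
    Matrix (FockIndex K) (FockIndex K) ℂ :=
  ((Real.pi : ℂ) ^ K)⁻¹ •
    opMul (opMul (displacement α) seed) (displacement α).conjTranspose

/-- For a state `ρ` of `A ⊗ B` (basis labels: pairs) and an effect `E` on `A`, the operator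
`Tr_A ((E ⊗ 1) ρ)` on `B`. -/
def partialTraceEffect {ι κ : Type} (E : Matrix ι ι ℂ) (ρ : Matrix (ι × κ) (ι × κ) ℂ) :
    Matrix κ κ ℂ :=
  Matrix.of fun m m' => ∑' n, ∑' n', E n n' * ρ (n', m) (n, m')

/-- The probability (density) `Tr ((E ⊗ 1) ρ)` of the outcome with effect `E`. -/
def outcomeDensity {ι κ : Type} (E : Matrix ι ι ℂ) (ρ : Matrix (ι × κ) (ι × κ) ℂ) : ℝ :=
  (opTrace (partialTraceEffect E ρ)).re

/-- The normalized state of `B` after the outcome with effect `E` on `A`,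
`Tr_A ((E ⊗ 1) ρ) / Tr ((E ⊗ 1) ρ)`. It is meaningful when the outcome density is positive. -/
def postMeasurementState {ι κ : Type} (E : Matrix ι ι ℂ) (ρ : Matrix (ι × κ) (ι × κ) ℂ) :
    Matrix κ κ ℂ :=
  ((outcomeDensity E ρ : ℂ))⁻¹ • partialTraceEffect E ρ

/-! ## Two-mode squeezed vacuum states and the swapping scenario -/

/-- Amplitudes of the two-mode squeezed vacuum state
`|ψ^r⟩ = √(1 - tanh² r) ∑_n (tanh r)^n |n n⟩`. -/
def tmsvs (r : ℝ) (n : FockIndex 2) : ℂ :=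
  if n 0 = n 1 then ((Real.sqrt (1 - Real.tanh r ^ 2) * Real.tanh r ^ n 0 : ℝ) : ℂ) else 0

/-- Amplitudes of `|ψ^{r₁}⟩_{S R₁} ⊗ |ψ^{r₂}⟩_{R₂ T}`, arranged bipartitely between `R` and `ST`:
the first label is that of the modes `(R₁, R₂)` and the second one that of the modes `(S, T)`. -/
def swapInput (r₁ r₂ : ℝ) (n : FockIndex 2 × FockIndex 2) : ℂ :=
  tmsvs r₁ ![n.2 0, n.1 0] * tmsvs r₂ ![n.1 1, n.2 1]

/-- The outcome density when `R` measures the POVM with seed `|ψ^{r₀}⟩` and obtains `α`. -/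
def swapDensity (r₀ r₁ r₂ : ℝ) (α : Fin 2 → ℂ) : ℝ :=
  outcomeDensity (povmElement (pureState (tmsvs r₀)) α) (pureState (swapInput r₁ r₂))

/-- The state between `S` and `T` when `R` measures the POVM with seed `|ψ^{r₀}⟩` and obtains
`α`. -/
def swapOutput (r₀ r₁ r₂ : ℝ) (α : Fin 2 → ℂ) : Matrix (FockIndex 2) (FockIndex 2) ℂ :=
  postMeasurementState (povmElement (pureState (tmsvs r₀)) α) (pureState (swapInput r₁ r₂))

/-- The Pauli matrix `Z`. -/
def pauliZ : Matrix (Fin 2) (Fin 2) ℝ := !![1, 0; 0, -1]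

/-- The block matrix `(cosh 2r · I₂, sinh 2r · Z; sinh 2r · Z, cosh 2r · I₂)`. -/
def tmsvsCovariance (r : ℝ) : Matrix (Fin 2 × Fin 2) (Fin 2 × Fin 2) ℝ :=
  Matrix.comp (Fin 2) (Fin 2) (Fin 2) (Fin 2) ℝ
    !![Real.cosh (2 * r) • 1, Real.sinh (2 * r) • pauliZ;
       Real.sinh (2 * r) • pauliZ, Real.cosh (2 * r) • 1]

end GaussianSwap

end

/-!
In the Bargmann representation a two-mode vector becomes an entire function of `(z₀, z₁)`, and every
vector of this problem is a multiple of `exp (l z₀ z₁ + b₀ z₀ + b₁ z₁)` for some `l ∈ [0, 1)`. The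
proof replaces this formula by the ladder relations `a₀ v = l a₁† v + b₀ v` and
`a₁ v = l a₀† v + b₁ v` (`IsGaussianVector`), which make sense for formal coefficient families and
which determine `v` up to a scalar.

* The two-mode squeezed vacuum is such a vector, with `l = tanh r` and `b = 0`. The exponential
  series of `D(α)` gives `a_j D(α) = D(α) (a_j + α_j)` and its adjoint, so `D(α)` changes `b` but
  not `l` (`IsDisplacementKernel.isGaussianVector_applyKernel`).
* The input state is perfectly correlated between `R` and `ST` in the Fock basis. Projecting `R` onto
  `D(α)|ψ^{r₀}⟩` therefore leaves `ST` in the conjugate of this vector, multiplied by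
  `(tanh r₁)^(m₀) (tanh r₂)^(m₁)`: a Gaussian vector with `l = tanh r₀ tanh r₁ tanh r₂`
  (`isGaussianVector_swapVector`).
* A Gaussian vector of norm one is a squeezed vacuum displaced by `β`: with `ã_j = a_j - β_j` the
  relations become homogeneous, `ã₀ φ = l ã₁† φ` and `ã₁ φ = l ã₀† φ`. Moving operators across the
  inner product with these relations yields linear equations for all first and second moments, which
  determine the covariance matrix (`IsGaussianVector.isCovarianceMatrix_pureState`).
* The characteristic function `⟨φ|D(ξ)|φ⟩` pairs `φ` with a Gaussian vector whose `b` is affine in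
  `(ξ, conj ξ)`. The pairing of two Gaussian vectors is an explicit exponential of a quadratic
  polynomial in their parameters `b` (`IsGaussianVector.pairing_eq`). It is found without integrals: along
  `t ↦ t^N u`, with `N` the photon number, the ladder relations turn the derivative of the pairing
  into a linear differential equation.

Convergence rests on `IsGaussianVector.mem_rapid`: the ladder relations with `l < 1` force the
coefficients of a Gaussian vector to decay geometrically in the photon number.
-/

noncomputable section
namespace GaussianSwap

/-! ### Geometrically decaying coefficient families and their pairing -/

/-- The total photon number `|n| = ∑_j n_j` of a Fock label. -/
def degree {K : ℕ} (n : FockIndex K) : ℕ := ∑ j, n j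

lemma degree_add_single {K : ℕ} (n : FockIndex K) (j : Fin K) :
    degree (n + Pi.single j 1) = degree n + 1 := by
  simp [degree, Finset.sum_add_distrib]

lemma degree_zero {K : ℕ} : degree (0 : FockIndex K) = 0 := by
  simp [degree]

lemma le_degree {K : ℕ} (n : FockIndex K) (j : Fin K) : n j ≤ degree n :=
  Finset.single_le_sum (f := n) (fun _ _ => Nat.zero_le _) (Finset.mem_univ j)

lemma sub_single_add_single {K : ℕ} {n : FockIndex K} {j : Fin K} (h : n j ≠ 0) :
    n - Pi.single j 1 + Pi.single j 1 = n := by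
  funext i
  by_cases hi : i = j
  · subst hi; simp; omega
  · simp [hi]

lemma add_single_sub_single {K : ℕ} (n : FockIndex K) (j : Fin K) :
    n + Pi.single j 1 - Pi.single j 1 = n := by
  funext i; simp

lemma degree_sub_single {K : ℕ} {n : FockIndex K} {j : Fin K} (h : n j ≠ 0) :
    degree (n - Pi.single j 1) + 1 = degree n := by
  rw [← degree_add_single, sub_single_add_single h]

@[simp] lemma annihilate_apply {K : ℕ} (j : Fin K) (ψ : FockIndex K → ℂ) (n : FockIndex K) :
    annihilate j ψ n = (Real.sqrt (n j + 1) : ℂ) * ψ (n + Pi.single j 1) := rfl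

@[simp] lemma create_apply {K : ℕ} (j : Fin K) (ψ : FockIndex K → ℂ) (n : FockIndex K) :
    create j ψ n = (Real.sqrt (n j) : ℂ) * ψ (n - Pi.single j 1) := rfl

lemma create_apply_add_single {K : ℕ} (j : Fin K) (ψ : FockIndex K → ℂ) (n : FockIndex K) :
    create j ψ (n + Pi.single j 1) = (Real.sqrt (n j + 1) : ℂ) * ψ n := by
  simp

lemma summable_pow_degree {s : ℝ} (h0 : 0 ≤ s) (h1 : s < 1) (K : ℕ) :
    Summable fun n : FockIndex K => s ^ degree n := by
  induction K with
  | zero => exact (hasSum_fintype _).summable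
  | succ K ih =>
    rw [← (Fin.consEquiv fun _ : Fin (K + 1) => ℕ).summable_iff]
    have h := (summable_geometric_of_lt_one h0 h1).mul_of_nonneg ih (fun _ => by positivity)
      (fun _ => by positivity)
    refine h.congr fun x => ?_
    simp [degree, Fin.sum_univ_succ, Fin.consEquiv, pow_add]

lemma exists_succ_mul_pow_le {s t : ℝ} (h0 : 0 < s) (h1 : s < t) :
    ∃ C : ℝ, 0 ≤ C ∧ ∀ k : ℕ, (k + 1 : ℝ) * s ^ k ≤ C * t ^ k := by
  have ht : 0 < t := h0.trans h1
  have hlt : s / t < 1 := (div_lt_one ht).2 h1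
  have hpos : 0 ≤ s / t := by positivity
  have l1 := (tendsto_self_mul_const_pow_of_lt_one hpos hlt).add
    (tendsto_pow_atTop_nhds_zero_of_lt_one hpos hlt)
  obtain ⟨C, hC⟩ := l1.bddAbove_range
  have hC' : ∀ k : ℕ, (k + 1 : ℝ) * (s / t) ^ k ≤ C := fun k => by
    have := hC ⟨k, rfl⟩
    simp only at this
    linarith
  refine ⟨C, le_trans (by positivity) (hC' 0), fun k => ?_⟩
  have := mul_le_mul_of_nonneg_right (hC' k) (pow_pos ht k).le
  rwa [div_pow, mul_assoc, div_mul_cancel₀ _ (pow_pos ht k).ne'] at this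

/-- Coefficient families with geometric decay, `‖ψ(n)‖ ≤ C s^|n|` for some `s < 1`: a common domain
for all polynomials in the ladder operators, on which every series below converges absolutely. -/
def rapid (K : ℕ) : Submodule ℂ (FockIndex K → ℂ) where
  carrier := {ψ | ∃ C s : ℝ, 0 ≤ C ∧ 0 < s ∧ s < 1 ∧ ∀ n, ‖ψ n‖ ≤ C * s ^ degree n}
  zero_mem' := ⟨0, 1 / 2, le_rfl, by norm_num, by norm_num, by simp⟩
  add_mem' := by
    rintro ψ χ ⟨C, s, hC, hs, hs1, h⟩ ⟨C', s', hC', hs', hs1', h'⟩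
    refine ⟨C + C', max s s', by positivity, lt_max_of_lt_left hs, max_lt hs1 hs1', fun n => ?_⟩
    have e1 : s ^ degree n ≤ max s s' ^ degree n := pow_le_pow_left₀ hs.le (le_max_left _ _) _
    have e2 : s' ^ degree n ≤ max s s' ^ degree n := pow_le_pow_left₀ hs'.le (le_max_right _ _) _
    calc ‖ψ n + χ n‖ ≤ C * s ^ degree n + C' * s' ^ degree n :=
          (norm_add_le _ _).trans (add_le_add (h n) (h' n))
      _ ≤ (C + C') * max s s' ^ degree n := by
          rw [add_mul]; gcongr
  smul_mem' := by
    rintro c ψ ⟨C, s, hC, hs, hs1, h⟩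
    refine ⟨‖c‖ * C, s, by positivity, hs, hs1, fun n => ?_⟩
    rw [Pi.smul_apply, norm_smul, mul_assoc]
    exact mul_le_mul_of_nonneg_left (h n) (norm_nonneg _)

lemma mem_rapid {K : ℕ} {ψ : FockIndex K → ℂ} :
    ψ ∈ rapid K ↔ ∃ C s : ℝ, 0 ≤ C ∧ 0 < s ∧ s < 1 ∧ ∀ n, ‖ψ n‖ ≤ C * s ^ degree n := Iff.rfl

lemma sqrt_natCast_add_one_le {k d : ℕ} (h : k ≤ d) : Real.sqrt (k + 1) ≤ d + 1 := by
  rw [Real.sqrt_le_left (by positivity)]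
  have : (k : ℝ) ≤ d := by exact_mod_cast h
  nlinarith [(Nat.cast_nonneg d : (0 : ℝ) ≤ d)]

lemma annihilate_mem_rapid {K : ℕ} {ψ : FockIndex K → ℂ} (h : ψ ∈ rapid K) (j : Fin K) :
    annihilate j ψ ∈ rapid K := by
  obtain ⟨C, s, hC, hs, hs1, h⟩ := h
  obtain ⟨t, hst, ht1⟩ := exists_between hs1
  obtain ⟨C', hC', hb⟩ := exists_succ_mul_pow_le hs hst
  refine ⟨C * s * C', t, by positivity, hs.trans hst, ht1, fun n => ?_⟩
  rw [annihilate_apply, norm_mul, Complex.norm_real, Real.norm_of_nonneg (Real.sqrt_nonneg _)]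
  calc _ ≤ (degree n + 1 : ℝ) * (C * s ^ (degree n + 1)) := by
        rw [← degree_add_single n j]
        exact mul_le_mul (sqrt_natCast_add_one_le (le_degree n j)) (h _) (norm_nonneg _)
          (by positivity)
    _ = C * s * ((degree n + 1 : ℝ) * s ^ degree n) := by ring
    _ ≤ C * s * (C' * t ^ degree n) := mul_le_mul_of_nonneg_left (hb _) (by positivity)
    _ = _ := by ring

lemma create_mem_rapid {K : ℕ} {ψ : FockIndex K → ℂ} (h : ψ ∈ rapid K) (j : Fin K) :
    create j ψ ∈ rapid K := by
  obtain ⟨C, s, hC, hs, hs1, h⟩ := h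
  obtain ⟨t, hst, ht1⟩ := exists_between hs1
  obtain ⟨C', hC', hb⟩ := exists_succ_mul_pow_le hs hst
  have ht : 0 < t := hs.trans hst
  refine ⟨C * C' / t, t, by positivity, ht, ht1, fun n => ?_⟩
  by_cases hn : n j = 0
  · rw [create_apply, hn]; simp; positivity
  obtain ⟨m, rfl⟩ : ∃ m : FockIndex K, n = m + Pi.single j 1 := ⟨_, (sub_single_add_single hn).symm⟩
  rw [create_apply_add_single, norm_mul, Complex.norm_real,
    Real.norm_of_nonneg (Real.sqrt_nonneg _), degree_add_single]
  calc _ ≤ (degree m + 1 : ℝ) * (C * s ^ degree m) :=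
        mul_le_mul (sqrt_natCast_add_one_le (le_degree m j)) (h _) (norm_nonneg _) (by positivity)
    _ = C * ((degree m + 1 : ℝ) * s ^ degree m) := by ring
    _ ≤ C * (C' * t ^ degree m) := mul_le_mul_of_nonneg_left (hb _) (by positivity)
    _ = _ := by rw [pow_succ]; field_simp

lemma star_mem_rapid {K : ℕ} {ψ : FockIndex K → ℂ} (h : ψ ∈ rapid K) : star ψ ∈ rapid K := by
  simpa only [mem_rapid, Pi.star_apply, norm_star] using h

/-- The bilinear pairing `∑_n ψ(n) χ(n)`. The inner product `⟨ψ|χ⟩` is `pairing (star ψ) χ`. -/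
def pairing {K : ℕ} (ψ χ : FockIndex K → ℂ) : ℂ := ∑' n, ψ n * χ n

lemma norm_mul_le_of_mem_rapid {K : ℕ} {ψ χ : FockIndex K → ℂ} (h : ψ ∈ rapid K)
    (h' : χ ∈ rapid K) :
    ∃ C s : ℝ, 0 ≤ C ∧ 0 < s ∧ s < 1 ∧ ∀ n, ‖ψ n * χ n‖ ≤ C * s ^ degree n := by
  obtain ⟨C, s, hC, hs, hs1, h⟩ := h
  obtain ⟨C', s', hC', hs', hs1', h'⟩ := h'
  refine ⟨C * C', s * s', by positivity, by positivity,
    mul_lt_one_of_nonneg_of_lt_one_left hs.le hs1 hs1'.le, fun n => ?_⟩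
  rw [norm_mul, mul_pow]
  calc _ ≤ (C * s ^ degree n) * (C' * s' ^ degree n) := by
        gcongr
        exacts [h n, h' n]
    _ = _ := by ring

lemma summable_mul_of_mem_rapid {K : ℕ} {ψ χ : FockIndex K → ℂ} (h : ψ ∈ rapid K)
    (h' : χ ∈ rapid K) : Summable fun n => ψ n * χ n := by
  obtain ⟨C, s, hC, hs, hs1, h⟩ := norm_mul_le_of_mem_rapid h h'
  exact Summable.of_norm_bounded ((summable_pow_degree hs.le hs1 K).mul_left C) h

lemma hasSum_pairing {K : ℕ} {ψ χ : FockIndex K → ℂ} (h : ψ ∈ rapid K) (h' : χ ∈ rapid K) :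
    HasSum (fun n => ψ n * χ n) (pairing ψ χ) :=
  (summable_mul_of_mem_rapid h h').hasSum

lemma pairing_comm {K : ℕ} (ψ χ : FockIndex K → ℂ) : pairing ψ χ = pairing χ ψ :=
  tsum_congr fun _ => mul_comm _ _

lemma pairing_add_right {K : ℕ} {ψ χ χ' : FockIndex K → ℂ} (h : ψ ∈ rapid K) (h₁ : χ ∈ rapid K)
    (h₂ : χ' ∈ rapid K) : pairing ψ (χ + χ') = pairing ψ χ + pairing ψ χ' := by
  unfold pairing
  rw [← (summable_mul_of_mem_rapid h h₁).tsum_add (summable_mul_of_mem_rapid h h₂)]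
  exact tsum_congr fun _ => mul_add _ _ _

lemma pairing_smul_right {K : ℕ} (c : ℂ) (ψ χ : FockIndex K → ℂ) :
    pairing ψ (c • χ) = c * pairing ψ χ := by
  unfold pairing
  rw [← tsum_mul_left]
  exact tsum_congr fun _ => mul_left_comm _ _ _

lemma pairing_add_left {K : ℕ} {ψ ψ' χ : FockIndex K → ℂ} (h₁ : ψ ∈ rapid K) (h₂ : ψ' ∈ rapid K)
    (h : χ ∈ rapid K) : pairing (ψ + ψ') χ = pairing ψ χ + pairing ψ' χ := by
  simp only [pairing_comm _ χ, pairing_add_right h h₁ h₂]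

lemma pairing_smul_left {K : ℕ} (c : ℂ) (ψ χ : FockIndex K → ℂ) :
    pairing (c • ψ) χ = c * pairing ψ χ := by
  simp only [pairing_comm _ χ, pairing_smul_right]

/-- `a_j` and `a_j†` are transposes of each other. This is a reindexing, so it needs no
convergence. -/
lemma pairing_annihilate {K : ℕ} (j : Fin K) (ψ χ : FockIndex K → ℂ) :
    pairing ψ (annihilate j χ) = pairing (create j ψ) χ := by
  have hinj : Function.Injective fun n : FockIndex K => n + Pi.single j 1 :=
    fun _ _ h => add_right_cancel h
  unfold pairing
  rw [← hinj.tsum_eq (f := fun n => create j ψ n * χ n)]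
  · refine tsum_congr fun n => ?_
    rw [create_apply_add_single, annihilate_apply]
    ring
  · intro n hn
    refine ⟨n - Pi.single j 1, sub_single_add_single fun h0 => hn ?_⟩
    simp [h0]

lemma pairing_create {K : ℕ} (j : Fin K) (ψ χ : FockIndex K → ℂ) :
    pairing ψ (create j χ) = pairing (annihilate j ψ) χ := by
  rw [pairing_comm, ← pairing_annihilate, pairing_comm]

/-! ### Matrix elements of the displacement operators -/

section commutators
variable {K : ℕ}

lemma annihilate_create_self (j : Fin K) :
    (annihilate j * create j : FormalOp K) = create j * annihilate j + 1 := by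
  refine LinearMap.ext fun ψ => funext fun n => ?_
  have e1 : (annihilate j * create j : FormalOp K) ψ n = ((n j + 1 : ℝ) : ℂ) * ψ n := by
    rw [Module.End.mul_apply, annihilate_apply, create_apply_add_single, ← mul_assoc,
      ← Complex.ofReal_mul, Real.mul_self_sqrt (by positivity)]
  have e2 : (create j * annihilate j : FormalOp K) ψ n = ((n j : ℝ) : ℂ) * ψ n := by
    by_cases hn : n j = 0
    · simp [hn]
    obtain ⟨m, rfl⟩ : ∃ m : FockIndex K, n = m + Pi.single j 1 :=
      ⟨_, (sub_single_add_single hn).symm⟩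
    rw [Module.End.mul_apply, create_apply_add_single, annihilate_apply, ← mul_assoc,
      ← Complex.ofReal_mul, Real.mul_self_sqrt (by positivity)]
    simp
  rw [LinearMap.add_apply, Pi.add_apply, e1, e2, Module.End.one_apply]
  push_cast
  ring

lemma annihilate_create_of_ne {i j : Fin K} (h : i ≠ j) :
    (annihilate i * create j : FormalOp K) = create j * annihilate i := by
  refine LinearMap.ext fun ψ => funext fun n => ?_
  simp only [Module.End.mul_apply, annihilate_apply, create_apply]
  have e : n + Pi.single i 1 - Pi.single j 1 = n - Pi.single j 1 + Pi.single i 1 ∨ n j = 0 := by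
    by_cases hn : n j = 0
    · exact Or.inr hn
    left
    funext k
    by_cases hk : k = j
    · subst hk; simp [h.symm]
    · simp [hk]
  rcases e with e | e
  · rw [e]; simp [h, h.symm]; ring
  · simp [e, h.symm]

lemma annihilate_create (i j : Fin K) :
    (annihilate i * create j : FormalOp K) = create j * annihilate i + if i = j then 1 else 0 := by
  split_ifs with h
  · subst h; exact annihilate_create_self i
  · rw [annihilate_create_of_ne h, add_zero]

lemma annihilate_comm (i j : Fin K) :
    (annihilate i * annihilate j : FormalOp K) = annihilate j * annihilate i := by
  by_cases h : i = j
  · rw [h]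
  refine LinearMap.ext fun ψ => funext fun n => ?_
  have h' : j ≠ i := fun e => h e.symm
  simp only [Module.End.mul_apply, annihilate_apply, Pi.add_apply, Pi.single_eq_of_ne h,
    Pi.single_eq_of_ne h', add_zero, add_right_comm n (Pi.single i 1)]
  ring

lemma create_comm (i j : Fin K) :
    (create i * create j : FormalOp K) = create j * create i := by
  by_cases h : i = j
  · rw [h]
  refine LinearMap.ext fun ψ => funext fun n => ?_
  have h' : j ≠ i := fun e => h e.symm
  have e : n - Pi.single i 1 - Pi.single j 1 = n - Pi.single j 1 - Pi.single i 1 := by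
    funext k; simp [Nat.sub_right_comm]
  simp only [Module.End.mul_apply, create_apply, Pi.sub_apply, Pi.single_eq_of_ne h,
    Pi.single_eq_of_ne h', tsub_zero, e]
  ring

lemma annihilate_mul_generator (α : Fin K → ℂ) (i : Fin K) :
    annihilate i * displacementGenerator α =
      displacementGenerator α * annihilate i + α i • (1 : FormalOp K) := by
  have h : ∀ j, annihilate i * (α j • create j - (starRingEnd ℂ) (α j) • annihilate j) =
      (α j • create j - (starRingEnd ℂ) (α j) • annihilate j) * annihilate i +
        if i = j then α j • (1 : FormalOp K) else 0 := fun j => by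
    rw [mul_sub, sub_mul, mul_smul_comm, mul_smul_comm, smul_mul_assoc, smul_mul_assoc,
      annihilate_create, annihilate_comm i j, smul_add]
    split_ifs
    · abel
    · simp
  rw [displacementGenerator, Finset.mul_sum, Finset.sum_mul, Finset.sum_congr rfl fun j _ => h j,
    Finset.sum_add_distrib]
  simp

lemma create_mul_generator (α : Fin K → ℂ) (i : Fin K) :
    create i * displacementGenerator α =
      displacementGenerator α * create i + (starRingEnd ℂ) (α i) • (1 : FormalOp K) := by
  have h : ∀ j, create i * (α j • create j - (starRingEnd ℂ) (α j) • annihilate j) =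
      (α j • create j - (starRingEnd ℂ) (α j) • annihilate j) * create i +
        if i = j then (starRingEnd ℂ) (α j) • (1 : FormalOp K) else 0 := fun j => by
    rw [mul_sub, sub_mul, mul_smul_comm, mul_smul_comm, smul_mul_assoc, smul_mul_assoc,
      annihilate_create, create_comm i j, smul_add]
    by_cases hij : i = j
    · subst hij; simp only [if_true]; abel
    · simp [hij, Ne.symm hij]
  rw [displacementGenerator, Finset.mul_sum, Finset.sum_mul, Finset.sum_congr rfl fun j _ => h j,
    Finset.sum_add_distrib]
  simp

/-- If `[A, G]` is a scalar `c`, then `[A, G^(k+1)] = (k + 1) c G^k`. -/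
lemma mul_pow_succ_of_commutator {A G : FormalOp K} {c : ℂ} (h : A * G = G * A + c • 1) (k : ℕ) :
    A * G ^ (k + 1) = G ^ (k + 1) * A + ((k + 1 : ℂ) * c) • G ^ k := by
  induction k with
  | zero => simp [h]
  | succ k ih =>
    rw [pow_succ G (k + 1), ← mul_assoc, ih, add_mul, mul_assoc, h, mul_add, smul_mul_assoc,
      ← pow_succ, ← mul_assoc, mul_smul_comm, mul_one, add_assoc, ← add_smul]
    congr 2
    push_cast
    ring

lemma annihilate_single (j : Fin K) (n : FockIndex K) :
    annihilate j (Pi.single n 1) = (Real.sqrt (n j) : ℂ) • Pi.single (n - Pi.single j 1) 1 := by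
  funext m
  rw [annihilate_apply, Pi.smul_apply, smul_eq_mul]
  by_cases hn : n j = 0
  · have : m + Pi.single j 1 ≠ n := fun h => by
      rw [← h] at hn; simp at hn
    simp [hn, this]
  · obtain ⟨k, rfl⟩ : ∃ k : FockIndex K, n = k + Pi.single j 1 :=
      ⟨_, (sub_single_add_single hn).symm⟩
    rw [add_single_sub_single]
    by_cases h : m = k
    · subst h; simp
    · simp [h]

lemma create_single (j : Fin K) (n : FockIndex K) :
    create j (Pi.single n 1) = (Real.sqrt (n j + 1) : ℂ) • Pi.single (n + Pi.single j 1) 1 := by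
  funext m
  rw [create_apply, Pi.smul_apply, smul_eq_mul]
  by_cases hm : m j = 0
  · have : m ≠ n + Pi.single j 1 := fun h => by
      rw [h] at hm; simp at hm
    simp [hm, this]
  · obtain ⟨k, rfl⟩ : ∃ k : FockIndex K, m = k + Pi.single j 1 :=
      ⟨_, (sub_single_add_single hm).symm⟩
    rw [add_single_sub_single]
    by_cases h : k = n
    · subst h; simp
    · simp [h]

end commutators

section convergence
variable {K : ℕ}

/-- On families supported on photon numbers at most `L`, the ladder operators are bounded by
`√(L + 1)` in the supremum norm. -/
lemma generator_bound (α : Fin K → ℂ) {ψ : FockIndex K → ℂ} {L : ℕ} {B : ℝ} (hB : 0 ≤ B)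
    (hsupp : ∀ m, L < degree m → ψ m = 0) (hψ : ∀ m, ‖ψ m‖ ≤ B) :
    (∀ m, L + 1 < degree m → displacementGenerator α ψ m = 0) ∧
      ∀ m, ‖displacementGenerator α ψ m‖ ≤ (2 * ∑ j, ‖α j‖) * Real.sqrt (L + 1) * B := by
  have key : ∀ j m, (L + 1 < degree m → create j ψ m = 0 ∧ annihilate j ψ m = 0) ∧
      ‖create j ψ m‖ ≤ Real.sqrt (L + 1) * B ∧ ‖annihilate j ψ m‖ ≤ Real.sqrt (L + 1) * B := by
    intro j m
    have hpos : 0 ≤ Real.sqrt (L + 1) * B := by positivity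
    refine ⟨fun hm => ⟨?_, ?_⟩, ?_, ?_⟩
    · rw [create_apply]
      by_cases h0 : m j = 0
      · simp [h0]
      · rw [hsupp _ (by have := degree_sub_single h0; omega), mul_zero]
    · rw [annihilate_apply, hsupp _ (by rw [degree_add_single]; omega), mul_zero]
    · rw [create_apply]
      by_cases h0 : m j = 0
      · simpa [h0] using hpos
      by_cases hd : L < degree (m - Pi.single j 1)
      · simpa [hsupp _ hd] using hpos
      rw [norm_mul, Complex.norm_real, Real.norm_of_nonneg (Real.sqrt_nonneg _)]
      refine mul_le_mul (Real.sqrt_le_sqrt ?_) (hψ _) (norm_nonneg _) (Real.sqrt_nonneg _)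
      have := degree_sub_single h0
      have := le_degree m j
      exact_mod_cast (show m j ≤ L + 1 by omega)
    · rw [annihilate_apply]
      by_cases hd : L < degree (m + Pi.single j 1)
      · simpa [hsupp _ hd] using hpos
      rw [norm_mul, Complex.norm_real, Real.norm_of_nonneg (Real.sqrt_nonneg _)]
      refine mul_le_mul (Real.sqrt_le_sqrt ?_) (hψ _) (norm_nonneg _) (Real.sqrt_nonneg _)
      rw [degree_add_single] at hd
      have := le_degree m j
      exact_mod_cast (show m j + 1 ≤ L + 1 by omega)
  have expand : ∀ m, displacementGenerator α ψ m =
      ∑ j, (α j * create j ψ m - (starRingEnd ℂ) (α j) * annihilate j ψ m) := fun m => by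
    simp [displacementGenerator, LinearMap.sum_apply, Finset.sum_apply]
  refine ⟨fun m hm => ?_, fun m => ?_⟩
  · rw [expand]
    exact Finset.sum_eq_zero fun j _ => by simp only [((key j m).1 hm).1, ((key j m).1 hm).2]; ring
  · rw [expand, mul_assoc, Finset.mul_sum, Finset.sum_mul]
    refine norm_sum_le_of_le _ fun j _ => (norm_sub_le _ _).trans ?_
    rw [norm_mul, norm_mul, RCLike.norm_conj]
    have h1 := mul_le_mul_of_nonneg_left (key j m).2.1 (norm_nonneg (α j))
    have h2 := mul_le_mul_of_nonneg_left (key j m).2.2 (norm_nonneg (α j))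
    linarith

lemma generator_pow_bound (α : Fin K → ℂ) (n : FockIndex K) (k : ℕ) :
    (∀ m, degree n + k < degree m → (displacementGenerator α ^ k) (Pi.single n 1) m = 0) ∧
      ∀ m, ‖(displacementGenerator α ^ k) (Pi.single n 1) m‖ ≤
        ∏ i ∈ Finset.range k, (2 * ∑ j, ‖α j‖) * Real.sqrt ((degree n + i : ℕ) + 1) := by
  induction k with
  | zero =>
    refine ⟨fun m hm => ?_, fun m => ?_⟩
    · have : m ≠ n := fun h => by subst h; omega
      simp [this]
    · by_cases h : m = n
      · subst h; simp
      · simp [h]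
  | succ k ih =>
    have h := generator_bound α (Finset.prod_nonneg fun i _ => by positivity) ih.1 ih.2
    simp only [pow_succ', Module.End.mul_apply]
    rw [Finset.prod_range_succ]
    refine ⟨h.1, fun m => (h.2 m).trans_eq (mul_comm _ _)⟩

/-- The exponential series of the displacement operators converges absolutely on Fock vectors. -/
lemma summable_displacement_series (α : Fin K → ℂ) (m n : FockIndex K) :
    Summable fun k : ℕ =>
      ((k.factorial : ℂ))⁻¹ * ((displacementGenerator α ^ k) (Pi.single n 1)) m := by
  set c : ℝ := 2 * ∑ j, ‖α j‖ with hc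
  have hc0 : 0 ≤ c := by positivity
  set β : ℕ → ℝ := fun k =>
    ((k.factorial : ℝ))⁻¹ * ∏ i ∈ Finset.range k, c * Real.sqrt ((degree n + i : ℕ) + 1) with hβ
  have hβ0 : ∀ k, 0 ≤ β k := fun k =>
    mul_nonneg (by positivity) (Finset.prod_nonneg fun i _ => by positivity)
  refine Summable.of_norm_bounded (g := β) ?_ fun k => ?_
  swap
  · rw [norm_mul, norm_inv, Complex.norm_natCast]
    exact mul_le_mul_of_nonneg_left ((generator_pow_bound α n k).2 m) (by positivity)
  -- the ratio of consecutive terms is `c √(|n| + k + 1) / (k + 1)`, eventually below `1 / 2`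
  have hratio : ∀ k, β (k + 1) = c * Real.sqrt ((degree n + k : ℕ) + 1) / (k + 1) * β k := by
    intro k
    simp only [hβ]
    rw [Finset.prod_range_succ, Nat.factorial_succ]
    push_cast
    field_simp
  refine summable_of_ratio_norm_eventually_le (r := 1 / 2) (by norm_num) ?_
  obtain ⟨N, hN⟩ := exists_nat_ge (8 * c ^ 2)
  filter_upwards [Filter.eventually_ge_atTop (max N (degree n))] with k hk
  rw [Real.norm_of_nonneg (hβ0 _), Real.norm_of_nonneg (hβ0 _), hratio]
  refine mul_le_mul_of_nonneg_right ?_ (hβ0 k)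
  rw [div_le_iff₀ (by positivity)]
  have h1 : (N : ℝ) ≤ k := by exact_mod_cast (le_max_left _ _).trans hk
  have h2 : (degree n : ℝ) ≤ k := by exact_mod_cast (le_max_right _ _).trans hk
  refine abs_le_of_sq_le_sq' ?_ (by positivity) |>.2
  rw [mul_pow, Real.sq_sqrt (by positivity)]
  push_cast
  calc c ^ 2 * ((degree n : ℝ) + k + 1) ≤ (k / 8 : ℝ) * (2 * (k + 1)) := by
        apply mul_le_mul <;> linarith
    _ ≤ _ := by nlinarith [(Nat.cast_nonneg k : (0 : ℝ) ≤ k)]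

end convergence

section kernel
variable {K : ℕ}

/-- Matrices `M` on Fock space intertwining the ladder operators with their translates,
`a_j M = M (a_j + α_j)` and `a_j† M = M (a_j† - γ_j)`, expressed through the columns and rows of
`M`. The displacement operator `D(α)` is the case `γ = -conj α`; with `γ` kept independent the notion
is stable under transposition. -/
structure IsDisplacementKernel (α γ : Fin K → ℂ) (M : Matrix (FockIndex K) (FockIndex K) ℂ) :
    Prop where
  column : ∀ j m n, annihilate j (fun m' => M m' n) m = create j (M m) n + α j * M m n
  row : ∀ j m n, annihilate j (M m) n = create j (fun m' => M m' n) m + γ j * M m n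

lemma IsDisplacementKernel.transpose {α γ : Fin K → ℂ} {M : Matrix (FockIndex K) (FockIndex K) ℂ}
    (h : IsDisplacementKernel α γ M) : IsDisplacementKernel γ α M.transpose :=
  ⟨fun j m n => h.row j n m, fun j m n => h.column j n m⟩

lemma hasSum_displacement (α : Fin K → ℂ) (m n : FockIndex K) :
    HasSum (fun k : ℕ =>
      ((k.factorial : ℂ))⁻¹ * ((displacementGenerator α ^ k) (Pi.single n 1)) m)
      (displacement α m n) :=
  (summable_displacement_series α m n).hasSum

/-- The exponential series turns `[A, G] = c` into `[A, exp G] = c exp G`. -/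
lemma hasSum_displacement_commutator (α : Fin K → ℂ) {A : FormalOp K} {c : ℂ}
    (h : A * displacementGenerator α = displacementGenerator α * A + c • 1) (m n : FockIndex K) :
    HasSum (fun k : ℕ => ((k.factorial : ℂ))⁻¹ *
      (A ((displacementGenerator α ^ k) (Pi.single n 1)) m -
        (displacementGenerator α ^ k) (A (Pi.single n 1)) m))
      (c * displacement α m n) := by
  rw [← hasSum_nat_add_iff' 1]
  simp only [Finset.sum_range_one, pow_zero, Module.End.one_apply, sub_self, mul_zero, sub_zero]
  refine ((hasSum_displacement α m n).mul_left c).congr_fun fun k => ?_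
  have e := congrFun (LinearMap.congr_fun (mul_pow_succ_of_commutator h k) (Pi.single n 1)) m
  simp only [Module.End.mul_apply, LinearMap.add_apply, LinearMap.smul_apply, Pi.add_apply,
    Pi.smul_apply, smul_eq_mul] at e
  rw [e, Nat.factorial_succ]
  have h1 : (k.factorial : ℂ) ≠ 0 := by exact_mod_cast k.factorial_ne_zero
  have h2 : (k + 1 : ℂ) ≠ 0 := by exact_mod_cast k.succ_ne_zero
  push_cast
  field_simp
  ring

lemma isDisplacementKernel_displacement (α : Fin K → ℂ) :
    IsDisplacementKernel α (fun j => -(starRingEnd ℂ) (α j)) (displacement α) := by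
  constructor
  · intro j m n
    have h := hasSum_displacement_commutator α (annihilate_mul_generator α j) m n
    have h1 := (hasSum_displacement α (m + Pi.single j 1) n).mul_left (Real.sqrt (m j + 1) : ℂ)
    have h2 := (hasSum_displacement α m (n - Pi.single j 1)).mul_left (Real.sqrt (n j) : ℂ)
    have h3 := h.unique ((h1.sub h2).congr_fun fun k => ?_)
    · rw [annihilate_apply, create_apply, h3]
      ring
    · simp only [annihilate_single, map_smul, annihilate_apply, Pi.smul_apply, smul_eq_mul]
      ring
  · intro j m n
    have h := hasSum_displacement_commutator α (create_mul_generator α j) m n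
    have h1 := (hasSum_displacement α (m - Pi.single j 1) n).mul_left (Real.sqrt (m j) : ℂ)
    have h2 := (hasSum_displacement α m (n + Pi.single j 1)).mul_left (Real.sqrt (n j + 1) : ℂ)
    have h3 := h.unique ((h1.sub h2).congr_fun fun k => ?_)
    · rw [annihilate_apply, create_apply, neg_mul, h3]
      ring
    · simp only [create_single, map_smul, create_apply, Pi.smul_apply, smul_eq_mul]
      ring

/-- The vacuum moments `⟨0|G^k|0⟩` of the displacement generator satisfy the recursion of Gaussian
moments: `G|0⟩ = ∑_j α_j a_j†|0⟩`, and commuting `a_j†` to the left, where it annihilates `⟨0|`, leaves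
`k + 1` copies of `-conj α_j ⟨0|G^k|0⟩`. -/
lemma generator_moment_recursion (α : Fin K → ℂ) (k : ℕ) :
    (displacementGenerator α ^ (k + 2)) (Pi.single 0 1) 0 =
      -((k + 1 : ℂ) * ∑ j, α j * (starRingEnd ℂ) (α j)) *
        (displacementGenerator α ^ k) (Pi.single 0 1) 0 := by
  have e0 : displacementGenerator α (Pi.single 0 1) = ∑ j, α j • create j (Pi.single 0 1) := by
    simp [displacementGenerator, LinearMap.sum_apply, annihilate_single]
  have e1 : ∀ j, (displacementGenerator α ^ (k + 1)) (create j (Pi.single 0 1)) 0 =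
      -((k + 1 : ℂ) * (starRingEnd ℂ) (α j)) *
        (displacementGenerator α ^ k) (Pi.single 0 1) 0 := fun j => by
    have e := congrFun (LinearMap.congr_fun
      (mul_pow_succ_of_commutator (create_mul_generator α j) k) (Pi.single 0 1)) 0
    simp only [Module.End.mul_apply, LinearMap.add_apply, LinearMap.smul_apply, Pi.add_apply,
      Pi.smul_apply, smul_eq_mul] at e
    rw [create_apply] at e
    simp only [Pi.zero_apply, Nat.cast_zero, Real.sqrt_zero, Complex.ofReal_zero, zero_mul] at e
    linear_combination -e
  rw [pow_succ, Module.End.mul_apply, e0, map_sum, Finset.sum_apply]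
  simp only [map_smul, Pi.smul_apply, e1, smul_eq_mul]
  rw [Finset.mul_sum, ← Finset.sum_neg_distrib, Finset.sum_mul]
  exact Finset.sum_congr rfl fun j _ => by ring

/-- The vacuum amplitude `⟨0|D(α)|0⟩ = exp (-|α|² / 2)`. -/
lemma displacement_zero_zero (α : Fin K → ℂ) :
    displacement α 0 0 = Complex.exp (-(∑ j, α j * (starRingEnd ℂ) (α j)) / 2) := by
  set S := ∑ j, α j * (starRingEnd ℂ) (α j) with hS
  set c : ℕ → ℂ := fun k => (displacementGenerator α ^ k) (Pi.single 0 1) 0 with hc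
  have hrec : ∀ k, c (k + 2) = -((k + 1 : ℂ) * S) * c k := generator_moment_recursion α
  have hc0 : c 0 = 1 := by simp [hc]
  have hc1 : c 1 = 0 := by
    simp [hc, displacementGenerator, LinearMap.sum_apply, annihilate_single]
  have hodd : ∀ k, c (2 * k + 1) = 0 := fun k => by
    induction k with
    | zero => exact hc1
    | succ k ih => rw [show 2 * (k + 1) + 1 = 2 * k + 1 + 2 by ring, hrec, ih, mul_zero]
  have heven : ∀ k, ((2 * k).factorial : ℂ)⁻¹ * c (2 * k) = (k.factorial : ℂ)⁻¹ * (-S / 2) ^ k := by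
    intro k
    induction k with
    | zero => simp [hc0]
    | succ k ih =>
      have h1 : ((2 * k).factorial : ℂ) ≠ 0 := by exact_mod_cast (2 * k).factorial_ne_zero
      have h2 : (k + 1 : ℂ) ≠ 0 := by exact_mod_cast k.succ_ne_zero
      have h3 : (2 * k + 1 : ℂ) ≠ 0 := by exact_mod_cast (2 * k).succ_ne_zero
      have h4 : (k.factorial : ℂ) ≠ 0 := by exact_mod_cast k.factorial_ne_zero
      have h5 : c (2 * k) = (2 * k).factorial * ((k.factorial : ℂ)⁻¹ * (-S / 2) ^ k) := by
        rw [← ih, mul_inv_cancel_left₀ h1]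
      rw [show 2 * (k + 1) = 2 * k + 2 by ring, hrec, h5, Nat.factorial_succ (2 * k + 1),
        Nat.factorial_succ (2 * k), Nat.factorial_succ k]
      push_cast
      have h6 : (2 * k + 1 + 1 : ℂ) ≠ 0 := by exact_mod_cast (2 * k + 1).succ_ne_zero
      field_simp
      ring
  have hexp : HasSum (fun k : ℕ => (k.factorial : ℂ)⁻¹ * (-S / 2) ^ k) (Complex.exp (-S / 2)) := by
    rw [Complex.exp_eq_exp_ℂ]
    simpa [smul_eq_mul] using NormedSpace.exp_series_hasSum_exp' (𝕂 := ℂ) (-S / 2)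
  refine (hasSum_displacement α 0 0).unique ?_
  have := HasSum.even_add_odd (f := fun k : ℕ => (k.factorial : ℂ)⁻¹ * c k)
    (hexp.congr_fun heven) (hasSum_zero.congr_fun fun k => by rw [hodd, mul_zero])
  simpa using this

end kernel

/-! ### Two-mode Gaussian vectors -/

/-- Two-mode Gaussian vectors, characterized algebraically by `a_0 v = l a_1† v + b_0 v` and
`a_1 v = l a_0† v + b_1 v`. In the Bargmann representation these are the multiples of
`exp (l z_0 z_1 + b_0 z_0 + b_1 z_1)`. -/
def IsGaussianVector (l : ℝ) (b : Fin 2 → ℂ) (v : FockIndex 2 → ℂ) : Prop :=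
  ∀ j, annihilate j v = (l : ℂ) • create j.rev v + b j • v

lemma fin_two_rev_ne (j : Fin 2) : j.rev ≠ j := by
  fin_cases j <;> decide

lemma IsGaussianVector.smul {l : ℝ} {b : Fin 2 → ℂ} {v : FockIndex 2 → ℂ}
    (h : IsGaussianVector l b v) (c : ℂ) : IsGaussianVector l b (c • v) := fun j => by
  rw [map_smul, map_smul, h j, smul_add, smul_comm c, smul_comm c]

lemma annihilate_star {K : ℕ} (j : Fin K) (v : FockIndex K → ℂ) :
    annihilate j (star v) = star (annihilate j v) := by
  funext n; simp

lemma create_star {K : ℕ} (j : Fin K) (v : FockIndex K → ℂ) :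
    create j (star v) = star (create j v) := by
  funext n; simp

lemma IsGaussianVector.conj {l : ℝ} {b : Fin 2 → ℂ} {v : FockIndex 2 → ℂ}
    (h : IsGaussianVector l b v) : IsGaussianVector l (star b) (star v) := fun j => by
  rw [annihilate_star, create_star, h j]
  funext n
  simp

/-- The Gaussian recursion contracts far from the vacuum, which forces geometric decay. -/
lemma IsGaussianVector.mem_rapid {l : ℝ} {b : Fin 2 → ℂ} {v : FockIndex 2 → ℂ}
    (h : IsGaussianVector l b v) (h0 : 0 ≤ l) (h1 : l < 1) : v ∈ rapid 2 := by
  obtain ⟨q, hq, hq1⟩ := exists_between h1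
  have hq0 : 0 < q := h0.trans_lt hq
  set μ := Real.sqrt q with hμ
  have hμ0 : 0 < μ := Real.sqrt_pos.2 hq0
  have hμ1 : μ < 1 := by rw [hμ, Real.sqrt_lt' one_pos]; simpa using hq1
  have hμq : μ ^ 2 = q := Real.sq_sqrt hq0.le
  set R := ∑ j, ‖b j‖ with hR
  have hR0 : 0 ≤ R := by positivity
  have hbR : ∀ j, ‖b j‖ ≤ R := fun j =>
    Finset.single_le_sum (f := fun j => ‖b j‖) (fun _ _ => norm_nonneg _) (Finset.mem_univ j)
  obtain ⟨N, hN⟩ := exists_nat_ge ((R / (q - l)) ^ 2)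
  -- beyond photon number `N`, the term `b_j v` is negligible against the gap `μ² - l`
  have hNs : ∀ k : ℕ, N ≤ k → R ≤ Real.sqrt (k + 1) * (q - l) := fun k hk => by
    rw [← div_le_iff₀ (by linarith)]
    refine Real.le_sqrt_of_sq_le (hN.trans ?_)
    have : (N : ℝ) ≤ k := by exact_mod_cast hk
    linarith
  obtain ⟨C, hC⟩ := ((Set.finite_Iic (fun _ : Fin 2 => N)).image
    fun n => ‖v n‖ / μ ^ degree n).bddAbove
  have hCb : ∀ n : FockIndex 2, (∀ j, n j ≤ N) → ‖v n‖ ≤ C * μ ^ degree n := fun n hn => by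
    rw [← div_le_iff₀ (by positivity)]
    exact hC ⟨n, hn, rfl⟩
  have hC0 : 0 ≤ C := by
    have := hCb 0 (by simp)
    simp only [degree_zero, pow_zero, mul_one] at this
    exact (norm_nonneg _).trans this
  refine ⟨C, μ, hC0, hμ0, hμ1, fun n => ?_⟩
  induction hd : degree n using Nat.strong_induction_on generalizing n with
  | _ d ih =>
  by_cases hn : ∀ j, n j ≤ N
  · rw [← hd]; exact hCb n hn
  obtain ⟨j, hj, hjr⟩ : ∃ j : Fin 2, N < n j ∧ n j.rev ≤ n j := by
    simp only [not_forall, not_le] at hn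
    obtain ⟨j, hj⟩ := hn
    rcases le_total (n j.rev) (n j) with h' | h'
    · exact ⟨j, hj, h'⟩
    · exact ⟨j.rev, hj.trans_le h', by rwa [Fin.rev_rev]⟩
  obtain ⟨m, rfl⟩ : ∃ m : FockIndex 2, n = m + Pi.single j 1 :=
    ⟨_, (sub_single_add_single (by omega)).symm⟩
  have hrev := fin_two_rev_ne j
  simp only [Pi.add_apply, Pi.single_eq_same, Pi.single_eq_of_ne hrev, add_zero] at hj hjr
  rw [degree_add_single] at hd
  subst hd
  set s := Real.sqrt (m j + 1) with hs
  have hspos : 0 < s := Real.sqrt_pos.2 (by positivity)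
  have hsR : R ≤ s * (q - l) := hNs _ (by omega)
  have hm := ih _ (Nat.lt_succ_self _) m rfl
  have hbm : ‖b j * v m‖ ≤ R * (C * μ ^ degree m) := by
    rw [norm_mul]
    exact mul_le_mul (hbR j) hm (norm_nonneg _) hR0
  have e := congrFun (h j) m
  rw [annihilate_apply, Pi.add_apply, Pi.smul_apply, Pi.smul_apply, smul_eq_mul, smul_eq_mul,
    create_apply] at e
  have e' : s * ‖v (m + Pi.single j 1)‖ =
      ‖(l : ℂ) * ((Real.sqrt (m j.rev) : ℂ) * v (m - Pi.single j.rev 1)) + b j * v m‖ := by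
    rw [← e, norm_mul, Complex.norm_real, Real.norm_of_nonneg hspos.le]
  refine le_of_mul_le_mul_left ?_ hspos
  rw [e']
  refine (norm_add_le _ _).trans ?_
  by_cases hz : m j.rev = 0
  · rw [hz]
    simp only [Nat.cast_zero, Real.sqrt_zero, Complex.ofReal_zero, zero_mul, mul_zero, norm_zero,
      zero_add]
    refine hbm.trans ?_
    have : R ≤ s * μ := hsR.trans (mul_le_mul_of_nonneg_left (by nlinarith) hspos.le)
    calc _ ≤ (s * μ) * (C * μ ^ degree m) := by gcongr
      _ = _ := by ring
  · have hdeg := degree_sub_single hz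
    have hm' := ih (degree (m - Pi.single j.rev 1)) (by omega) _ rfl
    rw [norm_mul, norm_mul, Complex.norm_real, Complex.norm_real, Real.norm_of_nonneg h0,
      Real.norm_of_nonneg (Real.sqrt_nonneg _)]
    have hsle : Real.sqrt (m j.rev) ≤ s :=
      Real.sqrt_le_sqrt (by exact_mod_cast hjr)
    rw [← hdeg] at hbm ⊢
    set k := degree (m - Pi.single j.rev 1)
    have h2 : l * (Real.sqrt (m j.rev) * ‖v (m - Pi.single j.rev 1)‖) ≤ l * (s * (C * μ ^ k)) := by
      gcongr
    have h3 : R * (C * μ ^ (k + 1)) ≤ s * (q - l) * (C * μ ^ k) := by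
      rw [pow_succ]
      calc R * (C * (μ ^ k * μ)) = (R * μ) * (C * μ ^ k) := by ring
        _ ≤ _ := by
          refine mul_le_mul_of_nonneg_right ?_ (by positivity)
          nlinarith
    calc _ ≤ l * (s * (C * μ ^ k)) + s * (q - l) * (C * μ ^ k) := by linarith
      _ = s * (C * (μ ^ k * μ ^ 2)) := by rw [hμq]; ring
      _ = _ := by ring

/-! ### Action of the displacement kernels on Gaussian vectors -/

/-- The vector `M v`, with `(M v)(m) = ∑_n M(m, n) v(n)`. -/
def applyKernel {K : ℕ} (M : Matrix (FockIndex K) (FockIndex K) ℂ) (v : FockIndex K → ℂ) :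
    FockIndex K → ℂ := fun m => pairing (M m) v

lemma IsDisplacementKernel.isGaussianVector_row_zero {α γ : Fin 2 → ℂ}
    {M : Matrix (FockIndex 2) (FockIndex 2) ℂ} (hM : IsDisplacementKernel α γ M) :
    IsGaussianVector 0 γ (M 0) := fun j => funext fun n => by
  rw [hM.row j 0 n]
  simp

lemma IsDisplacementKernel.row_mem_rapid {α γ : Fin 2 → ℂ}
    {M : Matrix (FockIndex 2) (FockIndex 2) ℂ} (hM : IsDisplacementKernel α γ M)
    (m : FockIndex 2) : M m ∈ rapid 2 := by
  induction hd : degree m generalizing m with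
  | zero =>
    have hm : m = 0 := funext fun j => Nat.le_zero.1 (hd ▸ le_degree m j)
    subst hm
    exact hM.isGaussianVector_row_zero.mem_rapid le_rfl one_pos
  | succ d ih =>
    obtain ⟨j, hj⟩ : ∃ j, m j ≠ 0 := by
      by_contra! h0
      simp [degree, h0] at hd
    obtain ⟨k, rfl⟩ : ∃ k : FockIndex 2, m = k + Pi.single j 1 :=
      ⟨_, (sub_single_add_single hj).symm⟩
    rw [degree_add_single] at hd
    have hk := ih k (by omega)
    have hs : (Real.sqrt (k j + 1) : ℂ) ≠ 0 :=
      Complex.ofReal_ne_zero.2 (Real.sqrt_pos.2 (by positivity)).ne'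
    have e : M (k + Pi.single j 1) =
        (Real.sqrt (k j + 1) : ℂ)⁻¹ • (create j (M k) + α j • M k) := funext fun n => by
      have := hM.column j k n
      rw [annihilate_apply] at this
      rw [Pi.smul_apply, Pi.add_apply, Pi.smul_apply, smul_eq_mul, smul_eq_mul, ← this,
        inv_mul_cancel_left₀ hs]
    rw [e]
    exact (rapid 2).smul_mem _ ((rapid 2).add_mem (create_mem_rapid hk j)
      ((rapid 2).smul_mem _ hk))

lemma IsDisplacementKernel.annihilate_applyKernel {α γ : Fin 2 → ℂ}
    {M : Matrix (FockIndex 2) (FockIndex 2) ℂ} (hM : IsDisplacementKernel α γ M)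
    {v : FockIndex 2 → ℂ} (hv : v ∈ rapid 2) (j : Fin 2) :
    annihilate j (applyKernel M v) = applyKernel M (annihilate j v) + α j • applyKernel M v := by
  funext m
  have hr := hM.row_mem_rapid
  have e : (Real.sqrt (m j + 1) : ℂ) • M (m + Pi.single j 1) = create j (M m) + α j • M m :=
    funext fun n => hM.column j m n
  simp only [applyKernel, annihilate_apply, Pi.add_apply, Pi.smul_apply, smul_eq_mul]
  rw [← pairing_smul_left, e, pairing_annihilate,
    pairing_add_left (create_mem_rapid (hr m) j) ((rapid 2).smul_mem _ (hr m)) hv,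
    pairing_smul_left]

lemma IsDisplacementKernel.applyKernel_create {α γ : Fin 2 → ℂ}
    {M : Matrix (FockIndex 2) (FockIndex 2) ℂ} (hM : IsDisplacementKernel α γ M)
    {v : FockIndex 2 → ℂ} (hv : v ∈ rapid 2) (j : Fin 2) :
    applyKernel M (create j v) = create j (applyKernel M v) + γ j • applyKernel M v := by
  funext m
  have hr := hM.row_mem_rapid
  have e : annihilate j (M m) = (Real.sqrt (m j) : ℂ) • M (m - Pi.single j 1) + γ j • M m :=
    funext fun n => hM.row j m n
  simp only [applyKernel, create_apply, Pi.add_apply, Pi.smul_apply, smul_eq_mul]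
  rw [pairing_create, e, pairing_add_left ((rapid 2).smul_mem _ (hr _)) ((rapid 2).smul_mem _ (hr m))
    hv, pairing_smul_left, pairing_smul_left]

/-- Displacement kernels map Gaussian vectors to Gaussian vectors with the same squeezing. -/
lemma IsDisplacementKernel.isGaussianVector_applyKernel {α γ : Fin 2 → ℂ}
    {M : Matrix (FockIndex 2) (FockIndex 2) ℂ} (hM : IsDisplacementKernel α γ M)
    {l : ℝ} {b : Fin 2 → ℂ} {v : FockIndex 2 → ℂ} (h : IsGaussianVector l b v)
    (h0 : 0 ≤ l) (h1 : l < 1) :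
    IsGaussianVector l (fun j => b j + α j + l * γ j.rev) (applyKernel M v) := fun j => by
  have hv := h.mem_rapid h0 h1
  have hr := hM.row_mem_rapid
  have e : applyKernel M (annihilate j v) =
      (l : ℂ) • applyKernel M (create j.rev v) + b j • applyKernel M v := by
    rw [h j]
    funext m
    simp only [applyKernel, Pi.add_apply, Pi.smul_apply, smul_eq_mul]
    rw [pairing_add_right (hr m) ((rapid 2).smul_mem _ (create_mem_rapid hv _))
      ((rapid 2).smul_mem _ hv), pairing_smul_right, pairing_smul_right]
  rw [hM.annihilate_applyKernel hv, e, hM.applyKernel_create hv]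
  module

/-! ### The Gaussian pairing formula -/

/-- The vector `t^N v`, where `N` is the total photon number. -/
def dilate (t : ℝ) (v : FockIndex 2 → ℂ) : FockIndex 2 → ℂ := fun n => (t : ℂ) ^ degree n * v n

lemma IsGaussianVector.dilation {l : ℝ} {b : Fin 2 → ℂ} {v : FockIndex 2 → ℂ}
    (h : IsGaussianVector l b v) (t : ℝ) :
    IsGaussianVector (l * t ^ 2) (fun j => t * b j) (dilate t v) := fun j => funext fun n => by
  have e := congrFun (h j) n
  simp only [Pi.add_apply, Pi.smul_apply, annihilate_apply, create_apply, smul_eq_mul,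
    dilate] at e ⊢
  rw [degree_add_single, pow_succ]
  by_cases hn : n j.rev = 0
  · simp only [hn, Nat.cast_zero, Real.sqrt_zero, Complex.ofReal_zero, zero_mul, mul_zero,
      zero_add] at e ⊢
    linear_combination (t : ℂ) ^ degree n * t * e
  · have hd := degree_sub_single hn
    push_cast
    rw [← hd, pow_succ]
    linear_combination (t : ℂ) ^ degree (n - Pi.single j.rev 1) * t * t * e

lemma dilate_mem_rapid {v : FockIndex 2 → ℂ} (hv : v ∈ rapid 2) {t : ℝ} (h0 : 0 ≤ t) (h1 : t ≤ 1) :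
    dilate t v ∈ rapid 2 := by
  obtain ⟨C, s, hC, hs, hs1, h⟩ := hv
  refine ⟨C, s, hC, hs, hs1, fun n => ?_⟩
  rw [dilate, norm_mul, norm_pow, Complex.norm_real, Real.norm_of_nonneg h0]
  exact (mul_le_of_le_one_left (norm_nonneg _) (pow_le_one₀ h0 h1)).trans (h n)

lemma hasDerivAt_pairing_dilate {u v : FockIndex 2 → ℂ} (hu : u ∈ rapid 2) (hv : v ∈ rapid 2)
    {t : ℝ} (h0 : 0 ≤ t) (h1 : t ≤ 1) :
    HasDerivAt (fun t : ℝ => pairing (dilate t u) v)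
      (∑' n, (degree n * (t : ℂ) ^ (degree n - 1)) * (u n * v n)) t := by
  obtain ⟨C, s, hC, hs, hs1, h⟩ := norm_mul_le_of_mem_rapid hu hv
  -- the power series in `t` converges beyond radius `1`, so termwise differentiation is allowed on
  -- the whole of `[0, 1]`
  obtain ⟨ρ, hρ1, hρs⟩ := exists_between ((one_lt_inv₀ hs).2 hs1)
  have hρ0 : 0 < ρ := one_pos.trans hρ1
  have hr1 : ρ * s < 1 := by
    have := mul_lt_mul_of_pos_right hρs hs
    rwa [inv_mul_cancel₀ hs.ne'] at this
  obtain ⟨q, hq, hq1⟩ := exists_between hr1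
  obtain ⟨C', hC', hb⟩ := exists_succ_mul_pow_le (by positivity : 0 < ρ * s) hq
  have hq0 : 0 < q := lt_trans (by positivity) hq
  have hmem : ∀ y : ℝ, 0 ≤ y → y ≤ 1 → y ∈ Metric.ball (0 : ℝ) ρ := fun y hy0 hy1 => by
    rw [mem_ball_zero_iff, Real.norm_of_nonneg hy0]; linarith
  have key := hasDerivAt_tsum_of_isPreconnected (𝕜 := ℝ) (F := ℂ) (t := Metric.ball (0 : ℝ) ρ)
    (g := fun (n : FockIndex 2) (y : ℝ) => (y : ℂ) ^ degree n * (u n * v n))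
    (g' := fun n y => (degree n * (y : ℂ) ^ (degree n - 1)) * (u n * v n))
    (u := fun n => C * C' * q ^ degree n) (y₀ := 1) (y := t)
    ((summable_pow_degree hq0.le hq1 2).mul_left _) Metric.isOpen_ball
    (convex_ball (0 : ℝ) ρ).isPreconnected ?_ ?_ (hmem 1 zero_le_one le_rfl) ?_ (hmem t h0 h1)
  · refine key.congr_of_eventuallyEq (Filter.Eventually.of_forall fun y => ?_)
    exact tsum_congr fun n => mul_assoc _ _ _
  · intro n y _
    have := (HasDerivAt.ofReal_comp (hasDerivAt_pow (degree n) y)).mul_const (u n * v n)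
    simpa using this
  · intro n y hy
    rw [mem_ball_zero_iff] at hy
    rw [norm_mul, norm_mul, norm_pow, Complex.norm_real, Complex.norm_natCast]
    have h1 : ‖y‖ ^ (degree n - 1) ≤ ρ ^ degree n :=
      (pow_le_pow_left₀ (norm_nonneg _) hy.le _).trans
        (pow_le_pow_right₀ hρ1.le (Nat.sub_le _ _))
    calc _ ≤ ((degree n + 1 : ℝ) * ρ ^ degree n) * (C * s ^ degree n) := by
          refine mul_le_mul (mul_le_mul (by linarith) h1 (by positivity) (by positivity)) (h n)
            (norm_nonneg _) (by positivity)
      _ = C * ((degree n + 1 : ℝ) * (ρ * s) ^ degree n) := by rw [mul_pow]; ring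
      _ ≤ C * (C' * q ^ degree n) := mul_le_mul_of_nonneg_left (hb _) hC
      _ = _ := by ring
  · simpa using summable_mul_of_mem_rapid hu hv

lemma create_annihilate_apply {K : ℕ} (j : Fin K) (ψ : FockIndex K → ℂ) (n : FockIndex K) :
    create j (annihilate j ψ) n = (n j : ℂ) * ψ n := by
  by_cases hn : n j = 0
  · simp [hn]
  obtain ⟨m, rfl⟩ : ∃ m : FockIndex K, n = m + Pi.single j 1 :=
    ⟨_, (sub_single_add_single hn).symm⟩
  rw [create_apply_add_single, annihilate_apply, ← mul_assoc,
    ← Complex.ofReal_mul, Real.mul_self_sqrt (by positivity)]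
  simp

/-- The derivative of the pairing along dilations is given by the number operator. -/
lemma mul_tsum_deriv_pairing_dilate {u v : FockIndex 2 → ℂ} (hu : u ∈ rapid 2) (hv : v ∈ rapid 2)
    {t : ℝ} (h0 : 0 ≤ t) (h1 : t ≤ 1) :
    (t : ℂ) * ∑' n, (degree n * (t : ℂ) ^ (degree n - 1)) * (u n * v n) =
      ∑ j, pairing (annihilate j (dilate t u)) (annihilate j v) := by
  have hd := dilate_mem_rapid hu h0 h1
  have hc : ∀ j, create j (annihilate j (dilate t u)) ∈ rapid 2 := fun j =>
    create_mem_rapid (annihilate_mem_rapid hd j) j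
  simp only [pairing_annihilate]
  unfold pairing
  rw [← tsum_mul_left, ← Summable.tsum_finsetSum fun j _ => summable_mul_of_mem_rapid (hc j) hv]
  refine tsum_congr fun n => ?_
  have e : ∀ k : ℕ, (t : ℂ) * (k * (t : ℂ) ^ (k - 1)) = k * (t : ℂ) ^ k := fun k => by
    cases k with
    | zero => simp
    | succ k => rw [Nat.add_sub_cancel, pow_succ]; ring
  simp only [create_annihilate_apply]
  rw [← mul_assoc, e, ← Finset.sum_mul, ← Finset.sum_mul]
  simp only [degree, dilate]
  push_cast
  ring

/-- Uniqueness for `t f' = t h' f` on `[0, 1]`. Substituting `t = s²` supplies the derivative at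
`0`, where the equation is void. -/
lemma eq_mul_exp_of_mul_deriv_eq {f f' h h' : ℝ → ℂ}
    (hf : ∀ t, 0 ≤ t → t ≤ 1 → HasDerivAt f (f' t) t)
    (hh : ∀ t, 0 ≤ t → t ≤ 1 → HasDerivAt h (h' t) t)
    (heq : ∀ t : ℝ, 0 ≤ t → t ≤ 1 → (t : ℂ) * f' t = t * (h' t * f t)) :
    f 1 = f 0 * Complex.exp (h 1 - h 0) := by
  set k : ℝ → ℂ := fun s => f (s ^ 2) * Complex.exp (-h (s ^ 2)) with hk
  have hder : ∀ s : ℝ, 0 ≤ s → s ≤ 1 → HasDerivAt k 0 s := fun s hs0 hs1 => by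
    have hs0' : 0 ≤ s ^ 2 := by positivity
    have hs1' : s ^ 2 ≤ 1 := pow_le_one₀ hs0 hs1
    have d := (hf _ hs0' hs1').mul (hh _ hs0' hs1').neg.cexp
    have d2 : HasDerivAt (fun s : ℝ => s ^ 2) (2 * s) s := by simpa using hasDerivAt_pow 2 s
    have d3 := HasDerivAt.scomp (h := fun s : ℝ => s ^ 2) s d d2
    refine d3.congr_deriv ?_
    rw [Complex.real_smul]
    by_cases hs : s = 0
    · simp [hs]
    · have e := heq _ hs0' hs1'
      have hne : ((s ^ 2 : ℝ) : ℂ) ≠ 0 := Complex.ofReal_ne_zero.2 (by positivity)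
      rw [mul_left_cancel₀ hne e]
      ring
  have hconst := constant_of_has_deriv_right_zero (f := k) (a := 0) (b := 1)
    (fun s hs => (hder s hs.1 hs.2).continuousAt.continuousWithinAt)
    (fun s hs => (hder s hs.1 hs.2.le).hasDerivWithinAt) 1 ⟨zero_le_one, le_rfl⟩
  simp only [hk, one_pow, ne_eq, OfNat.ofNat_ne_zero, not_false_eq_true, zero_pow] at hconst
  rw [sub_eq_add_neg, add_comm, Complex.exp_add, ← mul_assoc, ← hconst, mul_assoc,
    ← Complex.exp_add, neg_add_cancel, Complex.exp_zero, mul_one]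

/-- Contracting a Gaussian vector with the ladder operators: the first moments of the pairing solve
a linear system. -/
lemma IsGaussianVector.one_sub_mul_pairing_annihilate {l m : ℝ} {a b : Fin 2 → ℂ}
    {u v : FockIndex 2 → ℂ} (hu : IsGaussianVector l a u) (hv : IsGaussianVector m b v)
    (hur : u ∈ rapid 2) (hvr : v ∈ rapid 2) (j : Fin 2) :
    (1 - l * m : ℂ) * pairing u (annihilate j v) = (m * a j.rev + b j) * pairing u v := by
  have e1 : pairing u (annihilate j v) = m * pairing (annihilate j.rev u) v + b j * pairing u v := by
    rw [hv j, pairing_add_right hur ((rapid 2).smul_mem _ (create_mem_rapid hvr _))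
      ((rapid 2).smul_mem _ hvr), pairing_smul_right, pairing_smul_right, pairing_create]
  have e2 : pairing (annihilate j.rev u) v = l * pairing u (annihilate j v) +
      a j.rev * pairing u v := by
    rw [hu j.rev, Fin.rev_rev, pairing_add_left ((rapid 2).smul_mem _ (create_mem_rapid hur _))
      ((rapid 2).smul_mem _ hur) hvr, pairing_smul_left, pairing_smul_left, ← pairing_annihilate]
  linear_combination e1 + (m : ℂ) * e2

/-- The second moments of the pairing of two Gaussian vectors, by the same contraction. -/
lemma IsGaussianVector.pairing_annihilate_annihilate {l m : ℝ} {a b : Fin 2 → ℂ}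
    {u v : FockIndex 2 → ℂ} (hu : IsGaussianVector l a u) (hv : IsGaussianVector m b v)
    (hur : u ∈ rapid 2) (hvr : v ∈ rapid 2) (j : Fin 2) :
    pairing (annihilate j u) (annihilate j v) =
      l * (m * (pairing (annihilate j.rev u) (annihilate j.rev v) + pairing u v) +
        b j * pairing u (annihilate j.rev v)) + a j * pairing u (annihilate j v) := by
  have hva := annihilate_mem_rapid hvr j
  have e1 : pairing (annihilate j u) (annihilate j v) =
      l * pairing u (annihilate j.rev (annihilate j v)) + a j * pairing u (annihilate j v) := by
    rw [hu j, pairing_add_left ((rapid 2).smul_mem _ (create_mem_rapid hur _))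
      ((rapid 2).smul_mem _ hur) hva, pairing_smul_left, pairing_smul_left, ← pairing_annihilate]
  have e2 : annihilate j.rev (annihilate j v) =
      (m : ℂ) • (create j.rev (annihilate j.rev v) + v) + b j • annihilate j.rev v := by
    rw [hv j, map_add, map_smul, map_smul]
    have := LinearMap.congr_fun (annihilate_create_self j.rev) v
    simp only [Module.End.mul_apply, LinearMap.add_apply, Module.End.one_apply] at this
    rw [this]
  have hv' := annihilate_mem_rapid hvr j.rev
  rw [e1, e2, pairing_add_right hur ((rapid 2).smul_mem _ ((rapid 2).add_mem
      (create_mem_rapid hv' _) hvr)) ((rapid 2).smul_mem _ hv'),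
    pairing_smul_right, pairing_smul_right, pairing_add_right hur (create_mem_rapid hv' _) hvr,
    pairing_create]

/-- The Gaussian integral in Fock space: the pairing of two Gaussian vectors, in terms of their
vacuum amplitudes. -/
lemma IsGaussianVector.pairing_eq {l m : ℝ} {a b : Fin 2 → ℂ}
    {u v : FockIndex 2 → ℂ} (hu : IsGaussianVector l a u) (hv : IsGaussianVector m b v)
    (hl0 : 0 ≤ l) (hl1 : l < 1) (hm0 : 0 ≤ m) (hm1 : m < 1) :
    pairing u v = u 0 * v 0 * (1 - l * m : ℂ)⁻¹ *
      Complex.exp ((a 0 * b 0 + a 1 * b 1 + l * (b 0 * b 1) + m * (a 0 * a 1)) /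
        (1 - l * m)) := by
  have hur := hu.mem_rapid hl0 hl1
  have hvr := hv.mem_rapid hm0 hm1
  have hlm : l * m < 1 := mul_lt_one_of_nonneg_of_lt_one_left hl0 hl1 hm1.le
  have hlm0 : 0 ≤ l * m := mul_nonneg hl0 hm0
  have hden : ∀ t : ℝ, 0 ≤ t → t ≤ 1 → (1 - l * m * t ^ 2 : ℂ) ≠ 0 := fun t h0 h1 => by
    have : 1 - l * m * t ^ 2 ≠ 0 := by nlinarith [pow_le_one₀ h0 h1 (n := 2)]
    exact_mod_cast this
  set f : ℝ → ℂ := fun t => pairing (dilate t u) v with hf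
  have dsq : ∀ t : ℝ, HasDerivAt (fun t : ℝ => (t : ℂ) ^ 2) (2 * t) t := fun t => by
    simpa using HasDerivAt.ofReal_comp (hasDerivAt_pow 2 t)
  have did : ∀ t : ℝ, HasDerivAt (fun t : ℝ => (t : ℂ)) 1 t := fun t => by
    simpa using HasDerivAt.ofReal_comp (hasDerivAt_id t)
  have dden : ∀ t : ℝ, HasDerivAt (fun t : ℝ => (1 - l * m * t ^ 2 : ℂ)) (-(l * m * (2 * t))) t :=
    fun t => by simpa using ((dsq t).const_mul (l * m : ℂ)).const_sub 1
  set p : ℂ := a 0 * b 0 + a 1 * b 1 with hp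
  set q : ℂ := l * (b 0 * b 1) + m * (a 0 * a 1) with hq
  have dnum : ∀ t : ℝ, HasDerivAt (fun t : ℝ => (t * p + t ^ 2 * q : ℂ)) (p + 2 * t * q) t :=
    fun t => by simpa using ((did t).mul_const p).fun_add ((dsq t).mul_const q)
  -- multiplying by `1 - l m t²` removes the normalization, which leaves a logarithmic derivative with a
  -- rational primitive
  have main := eq_mul_exp_of_mul_deriv_eq (f := fun t => f t * (1 - l * m * t ^ 2))
    (h := fun t => (t * p + t ^ 2 * q) / (1 - l * m * t ^ 2))
    (fun t h0 h1 => (hasDerivAt_pairing_dilate hur hvr h0 h1).mul (dden t))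
    (fun t h0 h1 => (dnum t).div (dden t) (hden t h0 h1)) ?_
  · have h1 : dilate 1 u = u := funext fun n => by simp [dilate]
    have h0 : pairing (dilate 0 u) v = u 0 * v 0 := by
      have hz : ∀ n : FockIndex 2, n ≠ 0 → dilate 0 u n * v n = 0 := fun n hn => by
        obtain ⟨j, hj⟩ := Function.ne_iff.1 hn
        have : degree n ≠ 0 := fun h => hj (Nat.le_zero.1 (h ▸ le_degree n j))
        simp [dilate, this]
      rw [pairing, tsum_eq_single 0 hz]
      simp [dilate, degree_zero]
    simp only [hf, h1, h0] at main
    have hne := hden 1 zero_le_one le_rfl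
    simp only [Complex.ofReal_one, one_pow, mul_one, one_mul, Complex.ofReal_zero, ne_eq,
      OfNat.ofNat_ne_zero, not_false_eq_true, zero_pow, mul_zero, zero_mul, add_zero, zero_div,
      sub_zero] at main hne
    rw [show p + l * (b 0 * b 1) + m * (a 0 * a 1) = p + q by rw [hq]; ring, mul_right_comm,
      ← main, mul_inv_cancel_right₀ hne]
  -- the moments `A0, A1` and `Y0, Y1` of `(t^N u, v)` are known multiples of the pairing itself, and
  -- `Y0 + Y1` is `t` times its derivative
  · intro t h0 h1
    have hd := hden t h0 h1
    have hut := hu.dilation t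
    have hutr := dilate_mem_rapid hur h0 h1
    have hnum := mul_tsum_deriv_pairing_dilate hur hvr h0 h1
    have A0 := hut.one_sub_mul_pairing_annihilate hv hutr hvr 0
    have A1 := hut.one_sub_mul_pairing_annihilate hv hutr hvr 1
    have Y0 := hut.pairing_annihilate_annihilate hv hutr hvr 0
    have Y1 := hut.pairing_annihilate_annihilate hv hutr hvr 1
    rw [Fin.sum_univ_two] at hnum
    have r0 : (0 : Fin 2).rev = 1 := rfl
    have r1 : (1 : Fin 2).rev = 0 := rfl
    rw [r0] at A0 Y0
    rw [r1] at A1 Y1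
    push_cast at A0 A1 Y0 Y1
    simp only [hf]
    set F := pairing (dilate t u) v
    set a0 := pairing (dilate t u) (annihilate 0 v)
    set a1 := pairing (dilate t u) (annihilate 1 v)
    set y0 := pairing (annihilate 0 (dilate t u)) (annihilate 0 v)
    set y1 := pairing (annihilate 1 (dilate t u)) (annihilate 1 v)
    set G := ∑' n, (degree n * (t : ℂ) ^ (degree n - 1)) * (u n * v n)
    set D : ℂ := 1 - l * m * t ^ 2 with hD
    have A0' : D * a0 = (m * (t * a 1) + b 0) * F := by linear_combination A0
    have A1' : D * a1 = (m * (t * a 0) + b 1) * F := by linear_combination A1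
    have Y : D * (y0 + y1) = 2 * (l * m * t ^ 2) * F + l * t ^ 2 * (b 0 * a1 + b 1 * a0) +
        t * (a 0 * a0 + a 1 * a1) := by linear_combination Y0 + Y1
    clear_value D p q F a0 a1 y0 y1 G
    have hR : (t : ℂ) * (((p + 2 * t * q) * D - (t * p + t ^ 2 * q) * -(l * m * (2 * t))) / D ^ 2 *
        (F * D)) * D = t * ((p + 2 * t * q) * D + (t * p + t ^ 2 * q) * (l * m * (2 * t))) * F := by
      field_simp
      ring
    refine mul_right_cancel₀ hd ?_
    rw [hR]
    linear_combination D ^ 2 * hnum + D * Y + (l * t ^ 2 * b 1 + t * a 0) * A0' +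
      (l * t ^ 2 * b 0 + t * a 1) * A1' + t * (-(p + 2 * t * q) * F) * hD -
        2 * t * t * F * hq - (1 + l * m * t ^ 2) * t * F * hp

/-! ### Normalized Gaussian vectors are Gaussian states -/

lemma cosh_two_mul_eq_tanh (r : ℝ) :
    Real.cosh (2 * r) = (1 + Real.tanh r ^ 2) / (1 - Real.tanh r ^ 2) := by
  have hc := (Real.cosh_pos r).ne'
  have h := Real.cosh_sq_sub_sinh_sq r
  have e : 1 - Real.tanh r ^ 2 = 1 / Real.cosh r ^ 2 := by
    rw [Real.tanh_eq_sinh_div_cosh]; field_simp; linarith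
  rw [e, Real.cosh_two_mul, Real.tanh_eq_sinh_div_cosh]
  field_simp

lemma sinh_two_mul_eq_tanh (r : ℝ) :
    Real.sinh (2 * r) = 2 * Real.tanh r / (1 - Real.tanh r ^ 2) := by
  have hc := (Real.cosh_pos r).ne'
  have h := Real.cosh_sq_sub_sinh_sq r
  have e : 1 - Real.tanh r ^ 2 = 1 / Real.cosh r ^ 2 := by
    rw [Real.tanh_eq_sinh_div_cosh]; field_simp; linarith
  rw [e, Real.sinh_two_mul, Real.tanh_eq_sinh_div_cosh]
  field_simp

lemma characteristicFunction_pureState {K : ℕ} (φ : FockIndex K → ℂ) (ξ : Fin K → ℂ) :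
    characteristicFunction (pureState φ) ξ =
      pairing φ (applyKernel (displacement ξ).transpose (star φ)) := by
  refine tsum_congr fun n => ?_
  rw [applyKernel, pairing, ← tsum_mul_left]
  refine tsum_congr fun k => ?_
  simp only [pureState, Matrix.vecMulVec_apply, Matrix.transpose_apply]
  ring

/-- The displacement `β` of the Gaussian vector with parameters `l` and `b`, that is, the solution
of `β_j - l conj β_(1-j) = b_j`. -/
def gaussianMean (l : ℝ) (b : Fin 2 → ℂ) (j : Fin 2) : ℂ :=
  (b j + l * (starRingEnd ℂ) (b j.rev)) / (1 - l ^ 2)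

/-- The vector of quadrature means `(2 Re β_j, 2 Im β_j)` of the displacement `β`. -/
def quadratureMean (β : Fin 2 → ℂ) (i : Fin 2 × Fin 2) : ℝ :=
  if i.2 = 0 then 2 * (β i.1).re else 2 * (β i.1).im

lemma I_mul_phaseVector_dotProduct (ξ β : Fin 2 → ℂ) :
    Complex.I * ((phaseVector ξ ⬝ᵥ quadratureMean β : ℝ) : ℂ) =
      ∑ j, (ξ j * (starRingEnd ℂ) (β j) - (starRingEnd ℂ) (ξ j) * β j) := by
  simp only [dotProduct, Fintype.sum_prod_type, Fin.sum_univ_two, phaseVector, quadratureMean]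
  apply Complex.ext <;> simp
  ring

lemma phaseVector_tmsvsCovariance (ξ : Fin 2 → ℂ) (r : ℝ) :
    ((phaseVector ξ ⬝ᵥ (tmsvsCovariance r).mulVec (phaseVector ξ) : ℝ) : ℂ) =
      Real.cosh (2 * r) * (ξ 0 * (starRingEnd ℂ) (ξ 0) + ξ 1 * (starRingEnd ℂ) (ξ 1)) -
        Real.sinh (2 * r) * (ξ 0 * ξ 1 + (starRingEnd ℂ) (ξ 0) * (starRingEnd ℂ) (ξ 1)) := by
  generalize hc : Real.cosh (2 * r) = c
  generalize hs : Real.sinh (2 * r) = s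
  have e : phaseVector ξ ⬝ᵥ (tmsvsCovariance r).mulVec (phaseVector ξ) =
      c * ((ξ 0).re * (ξ 0).re + (ξ 0).im * (ξ 0).im + (ξ 1).re * (ξ 1).re + (ξ 1).im * (ξ 1).im) +
        s * (2 * ((ξ 0).im * (ξ 1).im - (ξ 0).re * (ξ 1).re)) := by
    simp only [dotProduct, Matrix.mulVec, Fintype.sum_prod_type, Fin.sum_univ_two, phaseVector,
      tmsvsCovariance, Matrix.comp_apply, hc, hs]
    simp [pauliZ]
    ring
  rw [e]
  apply Complex.ext <;> simp <;> ring

/-- The characteristic function `⟨φ|D(ξ)|φ⟩` is a pairing of two Gaussian vectors whose parameters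
depend affinely on `(ξ, conj ξ)`, hence a Gaussian function of `ξ`. -/
theorem IsGaussianVector.isGaussian_pureState {r : ℝ} (hr : 0 ≤ Real.tanh r) {b : Fin 2 → ℂ}
    {φ : FockIndex 2 → ℂ} (h : IsGaussianVector (Real.tanh r) b φ)
    (hnorm : pairing φ (star φ) = 1) : IsGaussian (pureState φ) := by
  refine ⟨quadratureMean (gaussianMean (Real.tanh r) b), tmsvsCovariance r, fun ξ => ?_⟩
  rw [I_mul_phaseVector_dotProduct, phaseVector_tmsvsCovariance, cosh_two_mul_eq_tanh,
    sinh_two_mul_eq_tanh]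
  have hr1 : Real.tanh r < 1 := Real.tanh_lt_one r
  generalize Real.tanh r = l at *
  have hl : (1 - (l : ℂ) ^ 2) ≠ 0 := by
    have : 1 - l ^ 2 ≠ 0 := by nlinarith
    exact_mod_cast this
  have hM := (isDisplacementKernel_displacement ξ).transpose
  have hw := hM.isGaussianVector_applyKernel h.conj hr hr1
  have e0 := hM.isGaussianVector_row_zero.pairing_eq h.conj le_rfl one_pos hr hr1
  have e1 := h.pairing_eq h.conj hr hr1 hr hr1
  have e2 := h.pairing_eq hw hr hr1 hr hr1
  rw [hnorm] at e1
  rw [characteristicFunction_pureState, e2, applyKernel, e0, Matrix.transpose_apply,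
    displacement_zero_zero]
  have r0 : (0 : Fin 2).rev = 1 := rfl
  have r1 : (1 : Fin 2).rev = 0 := rfl
  simp only [Fin.sum_univ_two, r0, r1, Pi.star_apply, Complex.star_def, gaussianMean, map_div₀,
    map_add, map_mul, map_sub, map_one, map_pow, Complex.conj_ofReal, Complex.conj_conj,
    Complex.ofReal_zero, zero_mul, sub_zero, inv_one, mul_one, div_one, add_zero] at e1 ⊢
  generalize (starRingEnd ℂ) (ξ 0) = x0
  generalize (starRingEnd ℂ) (ξ 1) = x1
  generalize (starRingEnd ℂ) (b 0) = c0 at *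
  generalize (starRingEnd ℂ) (b 1) = c1 at *
  generalize ξ 0 = y0
  generalize ξ 1 = y1
  generalize (starRingEnd ℂ) (φ 0) = φ0 at *
  push_cast
  -- dividing by the normalization `e1` leaves an identity between exponents
  have hexp : ∀ S X Y T Z u : ℂ, S + X + Y = T + Z → 1 = φ 0 * φ0 * u * Complex.exp Z →
      φ 0 * (Complex.exp S * φ0 * Complex.exp X) * u * Complex.exp Y = Complex.exp T := by
    intro S X Y T Z u hs h1
    have := congrArg Complex.exp hs
    rw [Complex.exp_add, Complex.exp_add, Complex.exp_add] at this
    linear_combination φ 0 * φ0 * u * this - Complex.exp T * h1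
  refine hexp _ _ _ _ _ _ ?_ e1
  rw [← pow_two] at *
  field_simp
  ring

/-! ### The covariance matrix of a normalized Gaussian vector -/

/-- The displaced annihilation operator `a_j - β_j`. -/
def annihilateAt {K : ℕ} (β : Fin K → ℂ) (j : Fin K) : FormalOp K := annihilate j - β j • 1

/-- The displaced creation operator `a_j† - conj β_j`. -/
def createAt {K : ℕ} (β : Fin K → ℂ) (j : Fin K) : FormalOp K :=
  create j - (starRingEnd ℂ) (β j) • 1

lemma annihilateAt_mem_rapid {K : ℕ} (β : Fin K → ℂ) {ψ : FockIndex K → ℂ} (h : ψ ∈ rapid K)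
    (j : Fin K) : annihilateAt β j ψ ∈ rapid K :=
  (rapid K).sub_mem (annihilate_mem_rapid h j) ((rapid K).smul_mem _ h)

lemma createAt_mem_rapid {K : ℕ} (β : Fin K → ℂ) {ψ : FockIndex K → ℂ} (h : ψ ∈ rapid K)
    (j : Fin K) : createAt β j ψ ∈ rapid K :=
  (rapid K).sub_mem (create_mem_rapid h j) ((rapid K).smul_mem _ h)

lemma annihilateAt_createAt {K : ℕ} (β : Fin K → ℂ) (i j : Fin K) (ψ : FockIndex K → ℂ) :
    annihilateAt β i (createAt β j ψ) =
      createAt β j (annihilateAt β i ψ) + (if i = j then 1 else 0 : ℂ) • ψ := by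
  have h := LinearMap.congr_fun (annihilate_create i j) ψ
  simp only [Module.End.mul_apply, LinearMap.add_apply] at h
  simp only [annihilateAt, createAt, LinearMap.sub_apply, LinearMap.smul_apply,
    Module.End.one_apply, map_sub, map_smul, h]
  split_ifs
  · rw [Module.End.one_apply]; module
  · rw [LinearMap.zero_apply]; module

lemma pairing_sub_smul_right {K : ℕ} {ψ χ χ' : FockIndex K → ℂ} (h : ψ ∈ rapid K)
    (h₁ : χ ∈ rapid K) (h₂ : χ' ∈ rapid K) (c : ℂ) :
    pairing ψ (χ - c • χ') = pairing ψ χ - c * pairing ψ χ' := by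
  rw [sub_eq_add_neg, ← neg_smul, pairing_add_right h h₁ ((rapid K).smul_mem _ h₂),
    pairing_smul_right, neg_mul, ← sub_eq_add_neg]

lemma pairing_star_createAt {K : ℕ} (β : Fin K → ℂ) (j : Fin K) {ψ χ : FockIndex K → ℂ}
    (hψ : ψ ∈ rapid K) (hχ : χ ∈ rapid K) :
    pairing (star ψ) (createAt β j χ) = pairing (star (annihilateAt β j ψ)) χ := by
  have e : star (annihilateAt β j ψ) =
      annihilate j (star ψ) - (starRingEnd ℂ) (β j) • star ψ := by
    rw [annihilate_star]; funext n; simp [annihilateAt]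
  have hs := star_mem_rapid hψ
  rw [e, createAt, LinearMap.sub_apply, LinearMap.smul_apply, Module.End.one_apply,
    pairing_sub_smul_right hs (create_mem_rapid hχ j) hχ, pairing_comm (_ - _) χ,
    pairing_sub_smul_right hχ (annihilate_mem_rapid hs j) hs, pairing_create, pairing_comm χ,
    pairing_comm χ]

lemma pairing_star_annihilateAt {K : ℕ} (β : Fin K → ℂ) (j : Fin K) {ψ χ : FockIndex K → ℂ}
    (hψ : ψ ∈ rapid K) (hχ : χ ∈ rapid K) :
    pairing (star ψ) (annihilateAt β j χ) = pairing (star (createAt β j ψ)) χ := by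
  have e : star (createAt β j ψ) = create j (star ψ) - β j • star ψ := by
    rw [create_star]; funext n; simp [createAt]
  have hs := star_mem_rapid hψ
  rw [e, annihilateAt, LinearMap.sub_apply, LinearMap.smul_apply, Module.End.one_apply,
    pairing_sub_smul_right hs (annihilate_mem_rapid hχ j) hχ, pairing_comm (_ - _) χ,
    pairing_sub_smul_right hχ (create_mem_rapid hs j) hs, pairing_annihilate, pairing_comm χ,
    pairing_comm χ]

section moments
variable {l : ℝ} {b : Fin 2 → ℂ} {φ : FockIndex 2 → ℂ}

/-- Around its mean, a Gaussian vector satisfies the homogeneous relations of a squeezed vacuum. -/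
lemma IsGaussianVector.annihilateAt_eq (h : IsGaussianVector l b φ) (h0 : 0 ≤ l) (h1 : l < 1)
    (j : Fin 2) : annihilateAt (gaussianMean l b) j φ =
      (l : ℂ) • createAt (gaussianMean l b) j.rev φ := by
  have hl : (1 - (l : ℂ) ^ 2) ≠ 0 := by
    have : 1 - l ^ 2 ≠ 0 := by nlinarith
    exact_mod_cast this
  have hb : b j = gaussianMean l b j - l * (starRingEnd ℂ) (gaussianMean l b j.rev) := by
    simp only [gaussianMean, map_div₀, map_add, map_mul, map_sub, map_one, map_pow,
      Complex.conj_ofReal, Complex.conj_conj, Fin.rev_rev]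
    field_simp
    ring
  simp only [annihilateAt, createAt, LinearMap.sub_apply, LinearMap.smul_apply,
    Module.End.one_apply, h j]
  rw [hb]
  module

lemma IsGaussianVector.pairing_star_createAt_eq (h : IsGaussianVector l b φ) (h0 : 0 ≤ l)
    (h1 : l < 1) (j : Fin 2) {χ : FockIndex 2 → ℂ} (hχ : χ ∈ rapid 2) :
    pairing (star φ) (createAt (gaussianMean l b) j χ) =
      l * pairing (star φ) (annihilateAt (gaussianMean l b) j.rev χ) := by
  have hφ := h.mem_rapid h0 h1
  have e : star ((l : ℂ) • createAt (gaussianMean l b) j.rev φ) =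
      (l : ℂ) • star (createAt (gaussianMean l b) j.rev φ) := by
    funext n; simp
  rw [pairing_star_createAt _ _ hφ hχ, h.annihilateAt_eq h0 h1, e, pairing_smul_left,
    pairing_star_annihilateAt _ _ hφ hχ]

lemma one_sub_sq_ne_zero_and_one_add_sq_ne_zero (h0 : 0 ≤ l) (h1 : l < 1) :
    (1 - (l : ℂ) ^ 2) ≠ 0 ∧ (1 + (l : ℂ) ^ 2) ≠ 0 := by
  have e1 : 1 - l ^ 2 ≠ 0 := by nlinarith
  have e2 : 1 + l ^ 2 ≠ 0 := by positivity
  exact ⟨by exact_mod_cast e1, by exact_mod_cast e2⟩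

lemma IsGaussianVector.expectation_annihilateAt (h : IsGaussianVector l b φ) (h0 : 0 ≤ l)
    (h1 : l < 1) (j : Fin 2) :
    pairing (star φ) (annihilateAt (gaussianMean l b) j φ) = 0 := by
  have hφ := h.mem_rapid h0 h1
  have e1 := h.pairing_star_createAt_eq h0 h1 j.rev hφ
  have e2 : pairing (star φ) (annihilateAt (gaussianMean l b) j φ) =
      l * pairing (star φ) (createAt (gaussianMean l b) j.rev φ) := by
    rw [h.annihilateAt_eq h0 h1, pairing_smul_right]
  rw [Fin.rev_rev] at e1
  refine (mul_eq_zero.1 ?_).resolve_left (one_sub_sq_ne_zero_and_one_add_sq_ne_zero h0 h1).1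
  linear_combination e2 + (l : ℂ) * e1

lemma IsGaussianVector.expectation_createAt (h : IsGaussianVector l b φ) (h0 : 0 ≤ l)
    (h1 : l < 1) (j : Fin 2) :
    pairing (star φ) (createAt (gaussianMean l b) j φ) = 0 := by
  rw [h.pairing_star_createAt_eq h0 h1 j (h.mem_rapid h0 h1), h.expectation_annihilateAt h0 h1,
    mul_zero]

lemma IsGaussianVector.expectation_createAt_annihilateAt (h : IsGaussianVector l b φ)
    (h0 : 0 ≤ l) (h1 : l < 1) (hnorm : pairing (star φ) φ = 1) (i j : Fin 2) :
    pairing (star φ) (createAt (gaussianMean l b) i (annihilateAt (gaussianMean l b) j φ)) =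
      (l : ℂ) ^ 2 / (1 - (l : ℂ) ^ 2) * if i = j then 1 else 0 := by
  have hφ := h.mem_rapid h0 h1
  have hs := star_mem_rapid hφ
  set β := gaussianMean l b with hβ
  -- moving both operators to the other side exchanges the modes, up to the commutator
  have step : ∀ i j, pairing (star φ) (createAt β i (annihilateAt β j φ)) =
      (l : ℂ) ^ 2 * (pairing (star φ) (createAt β j.rev (annihilateAt β i.rev φ)) +
        if i = j then 1 else 0) := fun i j => by
    rw [h.pairing_star_createAt_eq h0 h1 i (annihilateAt_mem_rapid _ hφ _), ← hβ,
      h.annihilateAt_eq h0 h1 j, ← hβ, map_smul, pairing_smul_right, annihilateAt_createAt,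
      pairing_add_right hs (createAt_mem_rapid _ (annihilateAt_mem_rapid _ hφ _) _)
        ((rapid 2).smul_mem _ hφ), pairing_smul_right, hnorm]
    simp only [Fin.rev_inj]
    ring
  have e1 := step i j
  have e2 := step j.rev i.rev
  simp only [Fin.rev_rev, Fin.rev_inj, eq_comm (a := j)] at e2
  obtain ⟨n1, n2⟩ := one_sub_sq_ne_zero_and_one_add_sq_ne_zero h0 h1
  have e3 := (mul_eq_zero.1 (show (1 + (l : ℂ) ^ 2) * ((1 - (l : ℂ) ^ 2) *
      pairing (star φ) (createAt β i (annihilateAt β j φ)) - l ^ 2 * if i = j then 1 else 0) = 0 by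
    linear_combination e1 + (l : ℂ) ^ 2 * e2)).resolve_left n2
  rw [div_mul_eq_mul_div, eq_div_iff n1]
  linear_combination e3

lemma IsGaussianVector.expectation_annihilateAt_createAt (h : IsGaussianVector l b φ)
    (h0 : 0 ≤ l) (h1 : l < 1) (hnorm : pairing (star φ) φ = 1) (i j : Fin 2) :
    pairing (star φ) (annihilateAt (gaussianMean l b) i (createAt (gaussianMean l b) j φ)) =
      1 / (1 - (l : ℂ) ^ 2) * if i = j then 1 else 0 := by
  have hφ := h.mem_rapid h0 h1
  have n1 := (one_sub_sq_ne_zero_and_one_add_sq_ne_zero h0 h1).1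
  rw [annihilateAt_createAt, pairing_add_right (star_mem_rapid hφ)
    (createAt_mem_rapid _ (annihilateAt_mem_rapid _ hφ _) _) ((rapid 2).smul_mem _ hφ),
    pairing_smul_right, hnorm, h.expectation_createAt_annihilateAt h0 h1 hnorm]
  simp only [eq_comm (a := j)]
  field_simp
  ring

lemma IsGaussianVector.expectation_annihilateAt_annihilateAt (h : IsGaussianVector l b φ)
    (h0 : 0 ≤ l) (h1 : l < 1) (hnorm : pairing (star φ) φ = 1) (i j : Fin 2) :
    pairing (star φ) (annihilateAt (gaussianMean l b) i (annihilateAt (gaussianMean l b) j φ)) =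
      l / (1 - (l : ℂ) ^ 2) * if i = j.rev then 1 else 0 := by
  rw [h.annihilateAt_eq h0 h1 j, map_smul, pairing_smul_right,
    h.expectation_annihilateAt_createAt h0 h1 hnorm]
  ring

lemma IsGaussianVector.expectation_createAt_createAt (h : IsGaussianVector l b φ)
    (h0 : 0 ≤ l) (h1 : l < 1) (hnorm : pairing (star φ) φ = 1) (i j : Fin 2) :
    pairing (star φ) (createAt (gaussianMean l b) i (createAt (gaussianMean l b) j φ)) =
      l / (1 - (l : ℂ) ^ 2) * if i = j.rev then 1 else 0 := by
  rw [h.pairing_star_createAt_eq h0 h1 i (createAt_mem_rapid _ (h.mem_rapid h0 h1) _),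
    h.expectation_annihilateAt_createAt h0 h1 hnorm]
  simp only [Fin.rev_eq_iff]
  ring

end moments

lemma hasExpectation_pureState {K : ℕ} {φ : FockIndex K → ℂ} {O : FormalOp K} (hφ : φ ∈ rapid K)
    (hO : O φ ∈ rapid K) : HasExpectation (pureState φ) O (pairing (star φ) (O φ)) := by
  refine (hasSum_pairing (star_mem_rapid hφ) hO).congr_fun fun n => ?_
  have e : (fun m => pureState φ m n) = star (φ n) • φ := funext fun m => by
    simp [pureState, Matrix.vecMulVec_apply, mul_comm]
  rw [e, map_smul]
  rfl

lemma hasFiniteSecondMoments_pureState {K : ℕ} {φ : FockIndex K → ℂ} (hφ : φ ∈ rapid K) :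
    HasFiniteSecondMoments (pureState φ) := by
  have hc : ∑ j, create j (annihilate j φ) ∈ rapid K :=
    (rapid K).sum_mem fun j _ => create_mem_rapid (annihilate_mem_rapid hφ j) j
  refine (Complex.reCLM.summable (summable_mul_of_mem_rapid hc (star_mem_rapid hφ))).congr
    fun n => ?_
  simp only [Complex.reCLM_apply, Finset.sum_apply, create_annihilate_apply, pureState,
    Matrix.vecMulVec_apply, ← Finset.sum_mul, mul_assoc]
  rw [← Complex.re_ofReal_mul]
  push_cast
  rfl

/-- The coefficients with which the centred quadratures `x_j` and `p_j` combine the displaced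
ladder operators: `x = a + a†` and `p = -i a + i a†`. -/
lemma quadrature_sub_mean (β : Fin 2 → ℂ) (i : Fin 2 × Fin 2) :
    quadrature i - (quadratureMean β i : ℂ) • (1 : FormalOp 2) =
      (![1, -Complex.I] i.2) • annihilateAt β i.1 + (![1, Complex.I] i.2) • createAt β i.1 := by
  obtain ⟨j, s⟩ := i
  fin_cases s
  · have e : ((2 * (β j).re : ℝ) : ℂ) = β j + (starRingEnd ℂ) (β j) := by
      apply Complex.ext <;> simp; ring
    simp only [quadrature, quadratureMean, annihilateAt, createAt, Fin.zero_eta, if_true, e,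
      Matrix.cons_val_zero]
    module
  · have e : ((2 * (β j).im : ℝ) : ℂ) = -Complex.I * (β j - (starRingEnd ℂ) (β j)) := by
      apply Complex.ext <;> simp; ring
    simp only [quadrature, quadratureMean, annihilateAt, createAt, Fin.mk_one, one_ne_zero, if_false,
      e, Matrix.cons_val_one, Matrix.cons_val_fin_one]
    module

theorem IsGaussianVector.isCovarianceMatrix_pureState {r : ℝ} (hr : 0 ≤ Real.tanh r)
    {b : Fin 2 → ℂ} {φ : FockIndex 2 → ℂ} (h : IsGaussianVector (Real.tanh r) b φ)
    (hnorm : pairing (star φ) φ = 1) :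
    IsCovarianceMatrix (pureState φ) (tmsvsCovariance r) := by
  have hr1 : Real.tanh r < 1 := Real.tanh_lt_one r
  have hφ := h.mem_rapid hr hr1
  have hs := star_mem_rapid hφ
  have n1 := (one_sub_sq_ne_zero_and_one_add_sq_ne_zero hr hr1).1
  set β := gaussianMean (Real.tanh r) b with hβ
  have hA : ∀ {ψ}, ψ ∈ rapid 2 → ∀ j, annihilateAt β j ψ ∈ rapid 2 :=
    fun hψ j => annihilateAt_mem_rapid β hψ j
  have hC : ∀ {ψ}, ψ ∈ rapid 2 → ∀ j, createAt β j ψ ∈ rapid 2 :=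
    fun hψ j => createAt_mem_rapid β hψ j
  refine ⟨hasFiniteSecondMoments_pureState hφ, quadratureMean β, fun i => ?_, fun i j => ?_⟩
  · have hq : quadrature i = (quadratureMean β i : ℂ) • (1 : FormalOp 2) +
        ((![1, -Complex.I] i.2) • annihilateAt β i.1 + (![1, Complex.I] i.2) • createAt β i.1) := by
      rw [← quadrature_sub_mean]; abel
    have hmem : (![1, -Complex.I] i.2) • annihilateAt β i.1 φ +
        (![1, Complex.I] i.2) • createAt β i.1 φ ∈ rapid 2 :=
      (rapid 2).add_mem ((rapid 2).smul_mem _ (hA hφ _)) ((rapid 2).smul_mem _ (hC hφ _))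
    have e : quadrature i φ = (quadratureMean β i : ℂ) • φ +
        ((![1, -Complex.I] i.2) • annihilateAt β i.1 φ +
          (![1, Complex.I] i.2) • createAt β i.1 φ) := by
      rw [hq]; rfl
    have key := hasExpectation_pureState (O := quadrature i) hφ
      (by rw [e]; exact (rapid 2).add_mem ((rapid 2).smul_mem _ hφ) hmem)
    rwa [e, pairing_add_right hs ((rapid 2).smul_mem _ hφ) hmem,
      pairing_add_right hs ((rapid 2).smul_mem _ (hA hφ _)) ((rapid 2).smul_mem _ (hC hφ _)),
      pairing_smul_right, pairing_smul_right, pairing_smul_right, hnorm,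
      h.expectation_annihilateAt hr hr1, h.expectation_createAt hr hr1, mul_one, mul_zero, mul_zero,
      add_zero, add_zero] at key
  · set Q : Fin 2 × Fin 2 → FormalOp 2 := fun i =>
      (![1, -Complex.I] i.2) • annihilateAt β i.1 + (![1, Complex.I] i.2) • createAt β i.1 with hQ
    have hQmem : ∀ {ψ}, ψ ∈ rapid 2 → ∀ i, Q i ψ ∈ rapid 2 := fun hψ i =>
      (rapid 2).add_mem ((rapid 2).smul_mem _ (hA hψ _)) ((rapid 2).smul_mem _ (hC hψ _))
    have hQQ : ∀ i j, pairing (star φ) (Q i (Q j φ)) =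
        (![1, -Complex.I] i.2) * ((![1, -Complex.I] j.2) *
            (Real.tanh r / (1 - (Real.tanh r : ℂ) ^ 2) * if i.1 = j.1.rev then 1 else 0) +
          (![1, Complex.I] j.2) * (1 / (1 - (Real.tanh r : ℂ) ^ 2) * if i.1 = j.1 then 1 else 0)) +
        (![1, Complex.I] i.2) * ((![1, -Complex.I] j.2) *
            ((Real.tanh r : ℂ) ^ 2 / (1 - (Real.tanh r : ℂ) ^ 2) * if i.1 = j.1 then 1 else 0) +
          (![1, Complex.I] j.2) *
            (Real.tanh r / (1 - (Real.tanh r : ℂ) ^ 2) * if i.1 = j.1.rev then 1 else 0)) := by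
      intro i j
      have e : Q i (Q j φ) =
          (![1, -Complex.I] i.2) • ((![1, -Complex.I] j.2) • annihilateAt β i.1 (annihilateAt β j.1 φ)
            + (![1, Complex.I] j.2) • annihilateAt β i.1 (createAt β j.1 φ)) +
          (![1, Complex.I] i.2) • ((![1, -Complex.I] j.2) • createAt β i.1 (annihilateAt β j.1 φ)
            + (![1, Complex.I] j.2) • createAt β i.1 (createAt β j.1 φ)) := by
        simp only [hQ, LinearMap.add_apply, LinearMap.smul_apply, map_add, map_smul]
        module
      have m1 := (rapid 2).smul_mem (![1, -Complex.I] j.2) (hA (hA hφ j.1) i.1)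
      have m2 := (rapid 2).smul_mem (![1, Complex.I] j.2) (hA (hC hφ j.1) i.1)
      have m3 := (rapid 2).smul_mem (![1, -Complex.I] j.2) (hC (hA hφ j.1) i.1)
      have m4 := (rapid 2).smul_mem (![1, Complex.I] j.2) (hC (hC hφ j.1) i.1)
      rw [e, pairing_add_right hs ((rapid 2).smul_mem _ ((rapid 2).add_mem m1 m2))
        ((rapid 2).smul_mem _ ((rapid 2).add_mem m3 m4)), pairing_smul_right, pairing_smul_right,
        pairing_add_right hs m1 m2, pairing_add_right hs m3 m4, pairing_smul_right,
        pairing_smul_right, pairing_smul_right, pairing_smul_right,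
        h.expectation_annihilateAt_annihilateAt hr hr1 hnorm,
        h.expectation_annihilateAt_createAt hr hr1 hnorm,
        h.expectation_createAt_annihilateAt hr hr1 hnorm,
        h.expectation_createAt_createAt hr hr1 hnorm]
    rw [quadrature_sub_mean, quadrature_sub_mean]
    change HasExpectation _ ((1 / 2 : ℂ) • (Q i * Q j + Q j * Q i)) _
    have mij := hQmem (hQmem hφ j) i
    have mji := hQmem (hQmem hφ i) j
    have key := hasExpectation_pureState (O := (1 / 2 : ℂ) • (Q i * Q j + Q j * Q i)) hφ
      ((rapid 2).smul_mem _ ((rapid 2).add_mem mij mji))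
    have e : ((1 / 2 : ℂ) • (Q i * Q j + Q j * Q i)) φ =
        (1 / 2 : ℂ) • (Q i (Q j φ) + Q j (Q i φ)) := rfl
    rw [e, pairing_smul_right, pairing_add_right hs mij mji, hQQ, hQQ] at key
    convert key using 1
    obtain ⟨i, x⟩ := i
    obtain ⟨j, y⟩ := j
    simp only [tmsvsCovariance, Matrix.comp_apply, cosh_two_mul_eq_tanh, sinh_two_mul_eq_tanh]
    generalize Real.tanh r = l at *
    fin_cases i <;> fin_cases j <;> fin_cases x <;> fin_cases y <;> simp [pauliZ] <;> ring_nf <;>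
      simp only [Complex.I_sq] <;> ring

/-! ### Entanglement swapping -/

lemma isGaussianVector_tmsvs (r : ℝ) : IsGaussianVector (Real.tanh r) 0 (tmsvs r) := fun j => by
  funext n
  simp only [Pi.add_apply, Pi.smul_apply, annihilate_apply, smul_eq_mul, Pi.zero_apply, zero_mul,
    add_zero]
  by_cases hn : n j.rev = 0
  · have : tmsvs r (n + Pi.single j 1) = 0 := by
      refine if_neg ?_
      fin_cases j <;> simp_all
    simp [this, hn]
  · obtain ⟨m, rfl⟩ : ∃ m : FockIndex 2, n = m + Pi.single j.rev 1 :=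
      ⟨_, (sub_single_add_single hn).symm⟩
    rw [create_apply_add_single]
    have e : (m + Pi.single j.rev 1 : FockIndex 2) j = m j := by
      simp [(fin_two_rev_ne j).symm]
    have e' : tmsvs r (m + Pi.single j.rev 1 + Pi.single j 1) = Real.tanh r * tmsvs r m := by
      have e0 : ∀ i, (m + Pi.single j.rev 1 + Pi.single j 1 : FockIndex 2) i = m i + 1 := by
        intro i
        fin_cases j <;> fin_cases i <;> simp
      simp only [tmsvs, e0, add_left_inj]
      split_ifs
      · push_cast; ring
      · simp
    rw [e, e']
    by_cases hm : m 0 = m 1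
    · have : m j = m j.rev := by fin_cases j <;> simp [hm]
      rw [this]; ring
    · simp [tmsvs, hm]

lemma tanh_nonneg {r : ℝ} (h : 0 ≤ r) : 0 ≤ Real.tanh r := by
  rw [Real.tanh_eq_sinh_div_cosh]
  exact div_nonneg (Real.sinh_nonneg_iff.2 h) (Real.cosh_pos r).le

lemma one_sub_tanh_sq_pos (r : ℝ) : 0 < 1 - Real.tanh r ^ 2 := by
  have h1 := Real.tanh_lt_one r
  have h2 := Real.neg_one_lt_tanh r
  nlinarith

lemma tmsvs_zero_ne_zero (r : ℝ) : tmsvs r 0 ≠ 0 := by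
  have h := (Real.sqrt_pos.2 (one_sub_tanh_sq_pos r)).ne'
  simp only [tmsvs, Pi.zero_apply, if_true, pow_zero, mul_one]
  exact Complex.ofReal_ne_zero.2 h

/-- The amplitude of the Fock label `m` in the input state `∑_m swapWeight m |m⟩_R |m⟩_{ST}`. -/
def swapWeight (r₁ r₂ : ℝ) (m : FockIndex 2) : ℝ :=
  Real.sqrt (1 - Real.tanh r₁ ^ 2) * Real.sqrt (1 - Real.tanh r₂ ^ 2) *
    (Real.tanh r₁ ^ m 0 * Real.tanh r₂ ^ m 1)

lemma swapInput_eq (r₁ r₂ : ℝ) (n m : FockIndex 2) :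
    swapInput r₁ r₂ (n, m) = if n = m then (swapWeight r₁ r₂ m : ℂ) else 0 := by
  simp only [swapInput, tmsvs, Matrix.cons_val_zero, Matrix.cons_val_one, Matrix.cons_val_fin_one]
  by_cases h : n = m
  · subst h
    simp [swapWeight]
    ring
  · rw [if_neg h]
    by_cases h0 : m 0 = n 0
    · have h1 : n 1 ≠ m 1 := fun h1 => h (funext fun i => by fin_cases i <;> simp [h0, h1])
      simp [h1]
    · simp [h0]

/-- The unnormalized vector of the post-measurement state. Since `R` and `ST` are perfectly
correlated in the Fock basis, projecting `R` onto `η = D(α)|ψ^{r₀}⟩` leaves `ST` in the conjugate of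
`η`, filtered by `(tanh r₁)^(m_0) (tanh r₂)^(m_1)`. -/
def swapVector (r₀ r₁ r₂ : ℝ) (α : Fin 2 → ℂ) (m : FockIndex 2) : ℂ :=
  swapWeight r₁ r₂ m * star (applyKernel (displacement α) (tmsvs r₀) m)

lemma povmElement_pureState_apply {K : ℕ} (ψ : FockIndex K → ℂ) (α : Fin K → ℂ)
    (m n : FockIndex K) :
    povmElement (pureState ψ) α m n = ((Real.pi : ℂ) ^ K)⁻¹ *
      (applyKernel (displacement α) ψ m * star (applyKernel (displacement α) ψ n)) := by
  have e1 : ∀ k, opMul (displacement α) (pureState ψ) m k =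
      applyKernel (displacement α) ψ m * star (ψ k) := fun k => by
    rw [applyKernel, pairing, ← tsum_mul_right]
    refine tsum_congr fun i => ?_
    simp only [pureState, Matrix.vecMulVec_apply, Pi.star_apply, mul_assoc]
  rw [povmElement, Matrix.smul_apply, smul_eq_mul]
  congr 1
  change ∑' k, opMul (displacement α) (pureState ψ) m k * (displacement α).conjTranspose k n = _
  rw [applyKernel, applyKernel, pairing, pairing, tsum_star, ← tsum_mul_left]
  refine tsum_congr fun k => ?_
  rw [e1, applyKernel, pairing, Matrix.conjTranspose_apply, star_mul']
  ring

lemma partialTraceEffect_swap (r₀ r₁ r₂ : ℝ) (α : Fin 2 → ℂ) :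
    partialTraceEffect (povmElement (pureState (tmsvs r₀)) α) (pureState (swapInput r₁ r₂)) =
      ((Real.pi : ℂ) ^ 2)⁻¹ • pureState (swapVector r₀ r₁ r₂ α) := by
  ext m m'
  change ∑' n, ∑' n', _ = _
  rw [tsum_eq_single m', tsum_eq_single m]
  · rw [povmElement_pureState_apply]
    simp only [pureState, Matrix.vecMulVec_apply, Pi.star_apply, swapInput_eq, if_true,
      Matrix.smul_apply, smul_eq_mul, swapVector, star_mul', Complex.star_def,
      Complex.conj_ofReal, Complex.conj_conj]
    ring
  · intro n' hn'
    simp [pureState, Matrix.vecMulVec_apply, swapInput_eq, hn']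
  · intro n hn
    simp [pureState, Matrix.vecMulVec_apply, swapInput_eq, hn]

lemma isGaussianVector_swapVector (r₀ r₁ r₂ : ℝ) (h₀ : 0 ≤ Real.tanh r₀) (α : Fin 2 → ℂ) :
    ∃ b, IsGaussianVector (Real.tanh r₀ * Real.tanh r₁ * Real.tanh r₂) b
      (swapVector r₀ r₁ r₂ α) := by
  have hη := ((isDisplacementKernel_displacement α).isGaussianVector_applyKernel
    (isGaussianVector_tmsvs r₀) h₀ (Real.tanh_lt_one r₀)).conj
  set η := star (applyKernel (displacement α) (tmsvs r₀)) with hηdef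
  have hv : ∀ m, swapVector r₀ r₁ r₂ α m = swapWeight r₁ r₂ m * η m := fun m => rfl
  obtain ⟨c, hc⟩ : ∃ c, IsGaussianVector (Real.tanh r₀) c η := ⟨_, hη⟩
  have hw : ∀ (j : Fin 2) n, swapWeight r₁ r₂ (n + Pi.single j 1) =
      ![Real.tanh r₁, Real.tanh r₂] j * swapWeight r₁ r₂ n := fun j n => by
    fin_cases j <;> simp [swapWeight, pow_succ] <;> ring
  have hp : ∀ j : Fin 2, ![Real.tanh r₁, Real.tanh r₂] j * ![Real.tanh r₁, Real.tanh r₂] j.rev =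
      Real.tanh r₁ * Real.tanh r₂ := fun j => by
    fin_cases j <;> simp [Fin.rev, mul_comm]
  refine ⟨fun j => ![Real.tanh r₁, Real.tanh r₂] j * c j, fun j => funext fun n => ?_⟩
  have e := congrFun (hc j) n
  simp only [Pi.add_apply, Pi.smul_apply, annihilate_apply, smul_eq_mul] at e ⊢
  rw [hv, hw]
  by_cases hn : n j.rev = 0
  · rw [create_apply, hn] at e ⊢
    rw [hv n]
    simp only [Nat.cast_zero, Real.sqrt_zero, Complex.ofReal_zero, zero_mul, mul_zero,
      zero_add] at e ⊢
    rw [Complex.ofReal_mul]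
    linear_combination (![Real.tanh r₁, Real.tanh r₂] j : ℂ) * swapWeight r₁ r₂ n * e
  · obtain ⟨m, rfl⟩ : ∃ m : FockIndex 2, n = m + Pi.single j.rev 1 :=
      ⟨_, (sub_single_add_single hn).symm⟩
    rw [create_apply_add_single] at e ⊢
    rw [hv, hv, hw j.rev]
    have hp' : (![Real.tanh r₁, Real.tanh r₂] j * ![Real.tanh r₁, Real.tanh r₂] j.rev : ℂ) =
      Real.tanh r₁ * Real.tanh r₂ := by exact_mod_cast hp j
    simp only [Complex.ofReal_mul]
    linear_combination ((![Real.tanh r₁, Real.tanh r₂] j * ![Real.tanh r₁, Real.tanh r₂] j.rev : ℂ)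
      * swapWeight r₁ r₂ m) * e + Real.tanh r₀ * Real.sqrt (m j.rev + 1) * swapWeight r₁ r₂ m * η m *
      hp'

lemma swapVector_zero_ne_zero (r₀ r₁ r₂ : ℝ) (h₀ : 0 ≤ Real.tanh r₀) (α : Fin 2 → ℂ) :
    swapVector r₀ r₁ r₂ α 0 ≠ 0 := by
  refine mul_ne_zero ?_ (star_ne_zero.2 ?_)
  · refine Complex.ofReal_ne_zero.2 (ne_of_gt ?_)
    have h1 := Real.sqrt_pos.2 (one_sub_tanh_sq_pos r₁)
    have h2 := Real.sqrt_pos.2 (one_sub_tanh_sq_pos r₂)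
    simp only [swapWeight, Pi.zero_apply, pow_zero, mul_one]
    positivity
  · rw [applyKernel, (isDisplacementKernel_displacement α).isGaussianVector_row_zero.pairing_eq
      (isGaussianVector_tmsvs r₀) le_rfl one_pos h₀ (Real.tanh_lt_one r₀), displacement_zero_zero]
    have := tmsvs_zero_ne_zero r₀
    simp [Complex.exp_ne_zero, this]

/-- The squared norm of a geometrically decaying family. -/
lemma pairing_star_self {K : ℕ} {φ : FockIndex K → ℂ} (hφ : φ ∈ rapid K) :
    Summable (fun n => ‖φ n‖ ^ 2) ∧ pairing φ (star φ) = ((∑' n, ‖φ n‖ ^ 2 : ℝ) : ℂ) := by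
  have e : ∀ n, φ n * star φ n = ((‖φ n‖ ^ 2 : ℝ) : ℂ) := fun n => by
    rw [Pi.star_apply, Complex.star_def, Complex.mul_conj, Complex.normSq_eq_norm_sq]
  have hs := summable_mul_of_mem_rapid hφ (star_mem_rapid hφ)
  simp only [e] at hs
  refine ⟨Complex.summable_ofReal.1 hs, ?_⟩
  rw [pairing, Complex.ofReal_tsum]
  exact tsum_congr e

lemma pureState_smul {ι : Type} (c : ℝ) (φ : ι → ℂ) :
    pureState ((c : ℂ) • φ) = ((c ^ 2 : ℝ) : ℂ) • pureState φ := by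
  ext m n
  simp only [pureState, Matrix.vecMulVec_apply, Pi.star_apply, Pi.smul_apply, smul_eq_mul,
    Matrix.smul_apply, star_mul', Complex.star_def, Complex.conj_ofReal]
  push_cast
  ring

/-- One outcome `α`: the projected vector is Gaussian with squeezing
`tanh r₀ tanh r₁ tanh r₂`, and normalizing it gives the post-measurement state. -/
theorem swap_outcome {r₀ r₁ r₂ r : ℝ} (t₀ : 0 ≤ Real.tanh r₀) (hr0 : 0 ≤ Real.tanh r)
    (hr : Real.tanh r = Real.tanh r₀ * Real.tanh r₁ * Real.tanh r₂) (α : Fin 2 → ℂ) :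
    0 < swapDensity r₀ r₁ r₂ α ∧
      (∃ ψ : FockSpace 2, ‖ψ‖ = 1 ∧
        swapOutput r₀ r₁ r₂ α = pureState (ψ : FockIndex 2 → ℂ)) ∧
      IsGaussian (swapOutput r₀ r₁ r₂ α) ∧
      IsCovarianceMatrix (swapOutput r₀ r₁ r₂ α) (tmsvsCovariance r) := by
  obtain ⟨b, hb⟩ := isGaussianVector_swapVector r₀ r₁ r₂ t₀ α
  have hφ0 := swapVector_zero_ne_zero r₀ r₁ r₂ t₀ α
  have hpart := partialTraceEffect_swap r₀ r₁ r₂ α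
  rw [← hr] at hb
  have hφ := hb.mem_rapid hr0 (Real.tanh_lt_one r)
  set φ := swapVector r₀ r₁ r₂ α
  obtain ⟨hsum, hN⟩ := pairing_star_self hφ
  set N := ∑' n, ‖φ n‖ ^ 2 with hNdef
  have hNpos : 0 < N := hsum.tsum_pos (fun _ => by positivity) 0 (by positivity)
  have hdens : swapDensity r₀ r₁ r₂ α = (Real.pi ^ 2)⁻¹ * N := by
    have : opTrace (((Real.pi : ℂ) ^ 2)⁻¹ • pureState φ) = (((Real.pi ^ 2)⁻¹ * N : ℝ) : ℂ) := by
      push_cast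
      rw [← hN, pairing, ← tsum_mul_left]
      rfl
    rw [swapDensity, outcomeDensity, hpart, this, Complex.ofReal_re]
  set c : ℝ := (Real.sqrt N)⁻¹ with hc
  have hcN : c ^ 2 = N⁻¹ := by rw [hc, inv_pow, Real.sq_sqrt hNpos.le]
  have hout : swapOutput r₀ r₁ r₂ α = pureState ((c : ℂ) • φ) := by
    have hd : outcomeDensity (povmElement (pureState (tmsvs r₀)) α)
      (pureState (swapInput r₁ r₂)) = (Real.pi ^ 2)⁻¹ * N := hdens
    rw [swapOutput, postMeasurementState, hd, hpart, pureState_smul, hcN, smul_smul]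
    congr 1
    have := Real.pi_ne_zero
    have := hNpos.ne'
    rw [← Complex.ofReal_pow, ← Complex.ofReal_inv, ← Complex.ofReal_inv, ← Complex.ofReal_mul]
    congr 1
    field_simp
  have hψ := hb.smul (c : ℂ)
  have hnorm : pairing ((c : ℂ) • φ) (star ((c : ℂ) • φ)) = 1 := by
    have e : star ((c : ℂ) • φ) = (c : ℂ) • star φ := by funext n; simp
    rw [e, pairing_smul_left, pairing_smul_right, hN, ← mul_assoc, ← pow_two, ← Complex.ofReal_pow,
      hcN, ← Complex.ofReal_mul, inv_mul_cancel₀ hNpos.ne', Complex.ofReal_one]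
  rw [hout]
  refine ⟨by rw [hdens]; positivity, ?_, hψ.isGaussian_pureState hr0 hnorm,
    hψ.isCovarianceMatrix_pureState hr0 (by rw [pairing_comm, hnorm])⟩
  obtain ⟨hs, hN1⟩ := pairing_star_self ((rapid 2).smul_mem (c : ℂ) hφ)
  have hs1 : ∑' n, ‖((c : ℂ) • φ) n‖ ^ 2 = 1 := by
    rw [hnorm] at hN1
    exact_mod_cast hN1.symm
  have hmem : Memℓp ((c : ℂ) • φ) 2 := memℓp_gen (by simpa using hs)
  refine ⟨⟨_, hmem⟩, ?_, rfl⟩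
  have h2 := lp.norm_rpow_eq_tsum (p := 2) (by norm_num) (⟨_, hmem⟩ : FockSpace 2)
  simp only [ENNReal.toReal_ofNat, Real.rpow_ofNat] at h2
  rw [hs1] at h2
  exact (pow_eq_one_iff_of_nonneg (norm_nonneg _) two_ne_zero).1 h2

end GaussianSwap
end

theorem mainTheorem8 (r₀ r₁ r₂ : ℝ) (h₀ : 0 ≤ r₀) (h₁ : 0 ≤ r₁) (h₂ : 0 ≤ r₂) :
    ∃ r : ℝ, 0 ≤ r ∧
      Real.tanh r = Real.tanh r₀ * Real.tanh r₁ * Real.tanh r₂ ∧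
      ∀ α : Fin 2 → ℂ,
        0 < GaussianSwap.swapDensity r₀ r₁ r₂ α ∧
        (∃ ψ : GaussianSwap.FockSpace 2, ‖ψ‖ = 1 ∧
          GaussianSwap.swapOutput r₀ r₁ r₂ α =
            GaussianSwap.pureState (ψ : GaussianSwap.FockIndex 2 → ℂ)) ∧
        GaussianSwap.IsGaussian (GaussianSwap.swapOutput r₀ r₁ r₂ α) ∧
        GaussianSwap.IsCovarianceMatrix (GaussianSwap.swapOutput r₀ r₁ r₂ α)
          (GaussianSwap.tmsvsCovariance r) := by
  have t₀ := GaussianSwap.tanh_nonneg h₀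
  have t₁ := GaussianSwap.tanh_nonneg h₁
  have t₂ := GaussianSwap.tanh_nonneg h₂
  have hl0 : 0 ≤ Real.tanh r₀ * Real.tanh r₁ * Real.tanh r₂ := by positivity
  have hl1 : Real.tanh r₀ * Real.tanh r₁ * Real.tanh r₂ < 1 :=
    mul_lt_one_of_nonneg_of_lt_one_right (mul_le_one₀ (Real.tanh_lt_one r₀).le t₁
      (Real.tanh_lt_one r₁).le) t₂ (Real.tanh_lt_one r₂)
  have hr := Real.tanh_artanh ⟨by linarith, hl1⟩
  exact ⟨_, Real.artanh_nonneg hl0, hr, GaussianSwap.swap_outcome t₀ (hl0.trans_eq hr.symm) hr⟩
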